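/- Let $\Omega'$ be the set of locally finite subsets of $\mathbb{R}^2$, with the $\sigma$-algebra $\mathcal{F}'$ generated by the counts $\bar\eta\mapsto|\bar\eta\cap A|$ ($A$ Borel), and let $\Omega=\bigcup_{\bar\eta\in\Omega'}\{-1,1\}^{\bar\eta}$, with the $\sigma$-algebra generated by $\bar\omega\mapsto|\bar\omega^{-1}(1)\cap A|$ and $\bar\omega\mapsto|\bar\omega^{-1}(-1)\cap A|$. Let $\mu$ be the law of a planar (càdlàg) Lévy process starting from $0$. Consider $\mu$-dynamical Voronoi percolation $(\omega^\mu(t))_{t\ge0}$ with underlying point process $(\eta^\mu(t))_{t\ge0}$: $\eta^\mu(0)=:\eta$ is a Poisson process of intensity $1$ in $\mathbb{R}^2$; given $\eta$, its points receive i.i.d. uniform colours in $\{-1,1\}$, which do not change in time, and the points move by i.i.d. displacements of law $\mu$, independent of the colours. For a finite $S\subseteq\eta^\mu(0)$ let $S_t\subseteq\eta^\mu(t)$ be the set of the positions at time $t$ of the points of $S=S_0$. Let $h:\Omega\to\mathbb{R}$ be bounded, measurable and not the zero function, such that a.s. the restriction $h^\eta$ of $h$ to $\{-1,1\}^\eta$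 depends on finitely many coordinates. Let $\mathbf{E}^\eta_{1/2}$ be the expectation under the uniform product measure on $\{-1,1\}^\eta$, let $\widehat{h^\eta}(S)=\mathbf{E}^\eta_{1/2}\big[h^\eta\prod_{x\in S}\omega(x)\big]$ for finite $S\subseteq\eta$, and for $A\in\mathcal{F}'$ let $$\widehat{\mathbb{Q}}^{an}_h[A]=\mathbb{E}\Big[\sum_{S\subseteq\eta\text{ finite},\,S\in A}\widehat{h^\eta}(S)^2\Big].$$ Let $B_1,B_2,\ldots\in\mathcal{F}'$ be pairwise disjoint with $\bigcup_{i\ge1}B_i=\{\text{non-empty finite subsets of }\mathbb{R}^2\}$, and let $A_i\in\mathcal{F}'$ with $A_i\subseteq B_i$ for every $i\ge 1$. Assume that for all $i\ge1$ and $t\ge0$, a.s. for every finite $S\subseteq\eta^\mu(0)$, $S\in B_i$ if and only if $S_t\in B_i$. For $i\ge1$ and $t\ge0$ let $\delta_1(i,t)>0$ and $\delta_2(i)>0$ be such that 1. $\mathbb{P}[S_t\in A_i\mid S_0=S]\le\delta_1(i,t)$ for every $S\in A_i$; 2. $\mathbb{P}[S_0\in A_i\mid S_t=S]\le\delta_1(i,t)$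 for every $S\in A_i$; 3. $\widehat{\mathbb{Q}}^{an}_h[A_i]\ge(1-\delta_2(i))\,\widehat{\mathbb{Q}}^{an}_h[B_i]$. Here the conditional probabilities are given, for each $t$, by any regular versions of the conditional laws of $S_t$ given $S_0$ and of $S_0$ given $S_t$, that is, by Markov kernels that disintegrate the measure $\mathbb{E}\big[\sum_{S\subseteq\eta^\mu(0)\text{ finite}}\delta_{(S_0,S_t)}\big]$ with respect to its first and its second marginal. Then, for every $t\ge0$, the variables $h(\omega^\mu(0))h(\omega^\mu(t))$ and $\mathbf{E}^\eta_{1/2}[h]^2$ are integrable and $$\mathbb{E}\big[h(\omega^\mu(0))h(\omega^\mu(t))\big]\le\mathbb{E}\big[\mathbf{E}^\eta_{1/2}[h]^2\big]+\sum_{i=1}^{\infty}\widehat{\mathbb{Q}}^{an}_h[B_i]\big(\delta_1(i,t)+2\sqrt{\delta_2(i)}\big),$$ where the sum on the right may be $+\infty$. -/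

import Mathlib

open MeasureTheory ProbabilityTheory Filter Topology
open scoped NNReal ENNReal

namespace VoronoiPerc

/-- The Euclidean plane, with its Borel sigma-algebra and Lebesgue measure `volume`. -/
abbrev Plane : Type := EuclideanSpace ℝ (Fin 2)

/-! ### Configurations -/

/-- A set of points of the plane is locally finite if it has finitely many points in every bounded
set. -/
def LocFinite (s : Set Plane) : Prop :=
  ∀ K : Set Plane, Bornology.IsBounded K → (s ∩ K).Finite

theorem LocFinite.of_finite {s : Set Plane} (hs : s.Finite) : LocFinite s :=
  fun _ _ => hs.subset Set.inter_subset_left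

/-- The set `Ω'` of locally finite subsets of the plane. -/
structure Config where
  /-- the set of points -/
  carrier : Set Plane
  locFinite : LocFinite carrier

/-- The sigma-algebra `𝓕'` on `Ω'`: it is generated by the counts `η ↦ |η ∩ A|`, `A` Borel. -/
noncomputable instance Config.instMeasurableSpace : MeasurableSpace Config :=
  ⨆ (A : Set Plane) (_ : MeasurableSet A),
    MeasurableSpace.comap (fun η : Config => (η.carrier ∩ A).encard) ⊤

/-- The set `Ω` of coloured locally finite configurations: a locally finite set `pts` together with
an element of `{-1, 1}^pts` (`ℤˣ` is the two-point set `{-1, 1}`). -/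
structure ColConfig where
  /-- the underlying uncoloured configuration -/
  pts : Config
  /-- the colours of its points -/
  color : pts.carrier → ℤˣ

/-- The points of colour `e`. -/
def ColConfig.ofColor (w : ColConfig) (e : ℤˣ) : Set Plane :=
  {y | ∃ hy : y ∈ w.pts.carrier, w.color ⟨y, hy⟩ = e}

/-- The sigma-algebra on `Ω`: it is generated by `w ↦ |w⁻¹(1) ∩ A|` and `w ↦ |w⁻¹(-1) ∩ A|`,
`A` Borel. -/
noncomputable instance ColConfig.instMeasurableSpace : MeasurableSpace ColConfig :=
  ⨆ (e : ℤˣ) (A : Set Plane) (_ : MeasurableSet A),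
    MeasurableSpace.comap (fun w : ColConfig => (w.ofColor e ∩ A).encard) ⊤

noncomputable section

/-- The finite subset `{p n : n ∈ I}` of the plane, as a configuration. -/
def finConfig {ι : Type*} (p : ι → Plane) (I : Finset ι) : Config :=
  ⟨p '' (I : Set ι), LocFinite.of_finite (I.finite_toSet.image p)⟩

open Classical in
/-- The coloured configuration whose points are the `p n`, the point `p n` having colour `c n`.
(If the `p n` are not pairwise distinct or not locally finite, which has probability zero at each
time in the dynamics below, then the value is the empty configuration.) -/
def mkColored (p : ℕ → Plane) (c : ℕ → ℤˣ) : ColConfig :=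
  if h : Function.Injective p ∧ LocFinite (Set.range p) then
    { pts := ⟨Set.range p, h.2⟩
      color := fun y => c ((Equiv.ofInjective p h.1).symm y) }
  else
    { pts := ⟨∅, LocFinite.of_finite Set.finite_empty⟩
      color := fun _ => 1 }

/-! ### Fourier coefficients and the annealed spectral measure -/

/-- The uniform law on `{-1, 1}`. -/
def coin : Measure ℤˣ :=
  (2⁻¹ : ℝ≥0∞) • Measure.dirac 1 + (2⁻¹ : ℝ≥0∞) • Measure.dirac (-1)

/-- The quenched law `P^η_{1/2}`: the uniform product measure on `{-1, 1}^η`. -/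
def quenchedLaw (η : Config) : Measure (η.carrier → ℤˣ) :=
  Measure.infinitePi fun _ => coin

/-- The restriction `h^η` of `h` to `{-1, 1}^η`. -/
def restrictTo (h : ColConfig → ℝ) (η : Config) (c : η.carrier → ℤˣ) : ℝ := h ⟨η, c⟩

/-- The quenched expectation `E^η_{1/2}[h]`. -/
def quenchedExp (h : ColConfig → ℝ) (η : Config) : ℝ :=
  ∫ c, restrictTo h η c ∂(quenchedLaw η)

/-- The Fourier function `χ_S^η(c) = ∏_{y ∈ S} c(y)`. -/
def chi {η : Config} (S : Finset η.carrier) (c : η.carrier → ℤˣ) : ℝ := ∏ y ∈ S, (((c y : ℤˣ) : ℤ) : ℝ)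

/-- The Fourier coefficient of `h^η` at the finite set `S ⊆ η`. -/
def fourierCoeff (h : ColConfig → ℝ) (η : Config) (S : Finset η.carrier) : ℝ :=
  ∫ c, restrictTo h η c * chi S c ∂(quenchedLaw η)

open Classical in
/-- The quenched un-normalised spectral mass of a set `A` of configurations, i.e. the sum of the
squared Fourier coefficients of `h^η` over the finite `S ⊆ η` with `S ∈ A`. -/
def quenchedSpectral (h : ColConfig → ℝ) (η : Config) (A : Set Config) : ℝ≥0∞ :=
  ∑' S : Finset η.carrier,
    if finConfig (fun y : η.carrier => (y : Plane)) S ∈ A then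
      ENNReal.ofReal (fourierCoeff h η S ^ 2) else 0

/-- The annealed un-normalised spectral mass of `A`: the expectation of the quenched one, for a
random configuration `η` (a Poisson process in the application) defined under `P`. -/
def annealedSpectral {Ω₀ : Type*} [MeasurableSpace Ω₀] (P : Measure Ω₀) (η : Ω₀ → Config)
    (h : ColConfig → ℝ) (A : Set Config) : ℝ≥0∞ :=
  ∫⁻ ω, quenchedSpectral h (η ω) A ∂P

/-! ### Poisson processes and Lévy processes -/

/-- The random set `η` is a Poisson process of intensity `1` in the plane: the number of points in a
Borel set of finite area is Poisson distributed with parameter the area, and the numbers of points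
in pairwise disjoint Borel sets are independent. -/
structure IsPoissonProcess {Ω₀ : Type*} [MeasurableSpace Ω₀] (P : Measure Ω₀)
    (η : Ω₀ → Set Plane) : Prop where
  law : ∀ A : Set Plane, MeasurableSet A → volume A ≠ ∞ →
    HasLaw (fun ω => (η ω ∩ A).encard)
      ((poissonMeasure (volume A).toNNReal).map (Nat.cast : ℕ → ℕ∞)) P
  indep : ∀ (k : ℕ) (A : Fin k → Set Plane), (∀ j, MeasurableSet (A j)) →
    Pairwise (fun j j' => Disjoint (A j) (A j')) →
    iIndepFun (fun j ω => (η ω ∩ A j).encard) P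

/-- The space of càdlàg paths `[0, ∞) → ℝ²`. -/
structure CadlagPath where
  /-- the path as a function -/
  val : ℝ≥0 → Plane
  cadlag : ∀ t, ContinuousWithinAt val (Set.Ici t) t ∧ ∃ l, Tendsto val (𝓝[<] t) (𝓝 l)

/-- The sigma-algebra generated by the evaluations. -/
instance CadlagPath.instMeasurableSpace : MeasurableSpace CadlagPath :=
  MeasurableSpace.comap (fun f : CadlagPath => f.val) MeasurableSpace.pi

/-- `μ` is the law of a planar Lévy process starting from `0`. -/
structure IsLevyLaw (μ : Measure CadlagPath) : Prop where
  isProbabilityMeasure : IsProbabilityMeasure μ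
  zero : ∀ᵐ f ∂μ, f.val 0 = 0
  indep : HasIndepIncrements (fun (t : ℝ≥0) (f : CadlagPath) => f.val t) μ
  stationary : ∀ s t : ℝ≥0,
    μ.map (fun f : CadlagPath => f.val (s + t) - f.val s) = μ.map (fun f : CadlagPath => f.val t)

/-! ### The dynamics -/

/-- A `μ`-dynamical Voronoi percolation process of parameter `1/2` defined under `P`. The points of
the initial Poisson process are enumerated without repetition as `x 0, x 1, …`; the point `x n` has
colour `ε n` for all times and is at `x n + X n t` at time `t`. Given the initial points, the
colours and the trajectories are independent, the colours uniform and the trajectories of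
law `μ`. -/
structure MuDynamics {Ω₀ : Type*} [MeasurableSpace Ω₀] (P : Measure Ω₀)
    (μ : Measure CadlagPath) where
  /-- the initial positions -/
  x : ℕ → Ω₀ → Plane
  /-- the colours -/
  ε : ℕ → Ω₀ → ℤˣ
  /-- the displacements -/
  X : ℕ → Ω₀ → CadlagPath
  measurable_x : ∀ n, Measurable (x n)
  measurable_ε : ∀ n, Measurable (ε n)
  measurable_X : ∀ n, Measurable (X n)
  injective : ∀ᵐ ω ∂P, Function.Injective fun n => x n ω
  poisson : IsPoissonProcess P fun ω => Set.range fun n => x n ω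
  joint_law :
    P.map (fun ω => ((fun n => x n ω), (fun n => (ε n ω, X n ω)))) =
      (P.map fun ω n => x n ω).prod (Measure.infinitePi fun _ : ℕ => coin.prod μ)

namespace MuDynamics

variable {Ω₀ : Type*} [MeasurableSpace Ω₀] {P : Measure Ω₀} {μ : Measure CadlagPath}

/-- The position at time `t` of the `n`-th point. -/
def pos (D : MuDynamics P μ) (t : ℝ≥0) (ω : Ω₀) (n : ℕ) : Plane := D.x n ω + (D.X n ω).val t

/-- The coloured configuration `ω^μ(t)`. -/
def colored (D : MuDynamics P μ) (t : ℝ≥0) (ω : Ω₀) : ColConfig :=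
  mkColored (D.pos t ω) fun n => D.ε n ω

/-- The uncoloured configuration `η^μ(t)`. -/
def points (D : MuDynamics P μ) (t : ℝ≥0) (ω : Ω₀) : Config := (D.colored t ω).pts

/-- The finite subsets `S` of `η^μ(0)` correspond to the finite sets `I` of labels; `D.sub I t` is
the set `S_t` of the positions at time `t` of the points with label in `I` (so `D.sub I 0` is
`S = S_0`). -/
def sub (D : MuDynamics P μ) (I : Finset ℕ) (t : ℝ≥0) (ω : Ω₀) : Config :=
  finConfig (D.pos t ω) I

/-- The expected number of finite `S ⊆ η^μ(0)` with `(S_s, S_t)` in a given set, as a measure on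
pairs of configurations. -/
def pairMeasure (D : MuDynamics P μ) (s t : ℝ≥0) : Measure (Config × Config) :=
  Measure.sum fun I : Finset ℕ => P.map fun ω => (D.sub I s ω, D.sub I t ω)

/-- `κ` is a regular version of the conditional law `P[S_t ∈ · | S_s = S]`, where `S` runs over the
finite subsets of the point process: `κ` disintegrates the law of `(S_s, S_t)` with respect to that
of `S_s`. -/
def IsCondLaw (D : MuDynamics P μ) (s t : ℝ≥0) (κ : Kernel Config Config) : Prop :=
  IsMarkovKernel κ ∧ (D.pairMeasure s t).IsCondKernel κ

end MuDynamics

end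

end VoronoiPerc

open VoronoiPerc

namespace VoronoiPerc

/-! Since colours stay attached to labels and are independent of positions and trajectories,
Parseval applied given the motion turns the covariance into the expectation of a sum, over finite
sets of labels, of products ab, where a and b are the Fourier coefficients of `h` at S_0 and at S_t.
The empty set contributes at most the mean of the two squared quenched expectations. By stationarity
both have the same mean, which gives the first term of the bound.

A non-empty set lies in one of the classes B_i and, by invariance, stays there. Write q for the
annealed spectral mass. If S_0 and S_t are both in A_i, use |ab| ≤ (a² + b²)/2: the a² part is
bounded by the forward conditional law and the b² part by the backward one, each giving at most δ₁
q(A_i). If S_0 or S_t is in B_i \ A_i, use weighted AM-GM with weight √δ₂, the larger factor 1/√δ₂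
going to the square at the set in B_i \ A_i. As q(B_i \ A_i) ≤ δ₂ q(B_i), each of these two cases
costs √δ₂ q(B_i). This is `MuDynamics.lintegral_class_le`.

Two facts about the dynamics carry this. First, given the whole initial configuration, and not just
S_0, the points of S_0 move by independent displacements; so an explicit conditional law,
`displacedProb`, inherits almost everywhere the bound assumed for the given kernel, and Fourier
weights depending on the whole configuration may be inserted (`lintegral_displaced_le`). Second, the
motion is reversible: as unlabelled families, the pairs (x, x + s) and (x - s, x) over a Poisson
process have the same law (`IsPoissonProcess.lintegral_displaced`). This yields stationarity and the
backward bound.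

Reversibility is proved with multiplicative functionals: the expectation of ∏ g(xₙ) is exp(-∫ (1 -
g)), marks are averaged out, and translation invariance of Lebesgue measure identifies the two
sides. Such functionals determine the law up to relabelling (`lintegral_eq_of_prodFn_eq`): they give
the joint law of the counts below rational levels of an injective real function, and these counts
determine the sorted sequence. Hence integrands to which reversibility is applied must be invariant
under permutations of the labels. -/

instance : MeasurableSingletonClass ℤˣ where
  measurableSet_singleton e :=
    ⟨{(e : ℤ)}, .of_discrete, by ext u; simp [Units.ext_iff]⟩

/-! ### Measurability of configurations built from sequences of points -/

/-- The count is at least k exactly when some k-element finite set of indices satisfies the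
condition, and there are countably many such sets. -/
theorem measurable_encard_setOf {α : Type*} [MeasurableSpace α] {p : ℕ → α → Prop}
    (hp : ∀ n, MeasurableSet {a | p n a}) : Measurable fun a => {n | p n a}.encard := by
  have hge : ∀ k : ℕ, MeasurableSet {a | (k : ℕ∞) ≤ {n | p n a}.encard} := by
    intro k
    have : {a | (k : ℕ∞) ≤ {n | p n a}.encard} =
        ⋃ (I : Finset ℕ) (_ : I.card = k), ⋂ n ∈ I, {a | p n a} := by
      ext a
      simp only [Set.mem_ofPred_eq, Set.mem_iUnion, Set.mem_iInter]
      constructor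
      · intro hk
        obtain ⟨t, ht, htk⟩ := Set.exists_subset_encard_eq hk
        have hfin : t.Finite := Set.finite_of_encard_eq_coe htk
        refine ⟨hfin.toFinset, ?_, fun n hn => ht (by simpa using hn)⟩
        rw [hfin.encard_eq_coe_toFinset_card] at htk
        exact_mod_cast htk
      · rintro ⟨I, rfl, hI⟩
        rw [← Set.encard_coe_eq_coe_finsetCard]
        exact Set.encard_le_encard fun n hn => hI n hn
    rw [this]
    exact MeasurableSet.iUnion fun I => MeasurableSet.iUnion fun _ =>
      Finset.measurableSet_biInter I fun n _ => hp n
  refine measurable_to_countable' fun k => ?_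
  induction k using ENat.recTopCoe with
  | top =>
    have : (fun a => {n | p n a}.encard) ⁻¹' {⊤} =
        ⋂ k : ℕ, {a | (k : ℕ∞) ≤ {n | p n a}.encard} := by
      ext a
      simp only [Set.mem_preimage, Set.mem_singleton_iff, Set.mem_iInter, Set.mem_ofPred_eq]
      exact ⟨fun h k => h ▸ le_top, fun h => ENat.eq_top_iff_forall_ge.2 h⟩
    rw [this]
    exact MeasurableSet.iInter hge
  | coe k =>
    have : (fun a => {n | p n a}.encard) ⁻¹' {(k : ℕ∞)} =
        {a | (k : ℕ∞) ≤ {n | p n a}.encard} \ {a | ((k + 1 : ℕ) : ℕ∞) ≤ {n | p n a}.encard} := by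
      ext a
      simp only [Set.mem_preimage, Set.mem_singleton_iff, Set.mem_sdiff, Set.mem_ofPred_eq,
        Nat.cast_add, Nat.cast_one, ENat.add_one_le_iff (ENat.natCast_ne_top k), not_lt]
      exact ⟨fun h => ⟨h.ge, h.le⟩, fun h => le_antisymm h.2 h.1⟩
    rw [this]
    exact (hge k).diff (hge (k + 1))

theorem measurable_config_iff {α : Type*} [MeasurableSpace α] {f : α → Config} :
    Measurable f ↔ ∀ A : Set Plane, MeasurableSet A →
      Measurable fun a => ((f a).carrier ∩ A).encard := by
  rw [measurable_iff_comap_le, Config.instMeasurableSpace, MeasurableSpace.comap_iSup]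
  simp only [MeasurableSpace.comap_iSup, MeasurableSpace.comap_comp, iSup_le_iff]
  exact forall₂_congr fun A _ => measurable_iff_comap_le.symm

theorem measurable_config_encard {A : Set Plane} (hA : MeasurableSet A) :
    Measurable fun S : Config => (S.carrier ∩ A).encard :=
  measurable_config_iff.1 measurable_id A hA

theorem measurable_colConfig_iff {α : Type*} [MeasurableSpace α] {f : α → ColConfig} :
    Measurable f ↔ ∀ (e : ℤˣ) (A : Set Plane), MeasurableSet A →
      Measurable fun a => ((f a).ofColor e ∩ A).encard := by
  rw [measurable_iff_comap_le, ColConfig.instMeasurableSpace, MeasurableSpace.comap_iSup]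
  simp only [MeasurableSpace.comap_iSup, MeasurableSpace.comap_comp, iSup_le_iff]
  exact forall₃_congr fun e A _ => measurable_iff_comap_le.symm

theorem Config.ext' {S T : Config} (h : S.carrier = T.carrier) : S = T := by
  cases S; cases T; simp_all

/-- Each value is counted at its first index. This avoids assuming `p` injective, so that maps into
configurations are measurable everywhere and not only off a null set. -/
theorem encard_image_inter (p : ℕ → Plane) (I : Set ℕ) (A : Set Plane) :
    (p '' I ∩ A).encard =
      {n | n ∈ I ∧ p n ∈ A ∧ ∀ m, m < n → m ∈ I → p m ≠ p n}.encard := by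
  rw [← Set.InjOn.encard_image (f := p)]
  · congr 1
    ext y
    constructor
    · rintro ⟨⟨n, hn, rfl⟩, hA⟩
      have hex : ∃ m, m ∈ I ∧ p m = p n := ⟨n, hn, rfl⟩
      classical
      refine ⟨Nat.find hex, ⟨(Nat.find_spec hex).1, ?_, ?_⟩, (Nat.find_spec hex).2⟩
      · rw [(Nat.find_spec hex).2]; exact hA
      · intro m hm hmI hpm
        exact Nat.find_min hex hm ⟨hmI, hpm.trans (Nat.find_spec hex).2⟩
    · rintro ⟨n, ⟨hn, hA, _⟩, rfl⟩
      exact ⟨⟨n, hn, rfl⟩, hA⟩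
  · rintro n ⟨hn, _, hn'⟩ m ⟨hm, _, hm'⟩ hnm
    rcases lt_trichotomy n m with hlt | heq | hlt
    · exact absurd hnm (hm' n hlt hn)
    · exact heq
    · exact absurd hnm.symm (hn' m hlt hm)

theorem measurable_finConfig (I : Finset ℕ) : Measurable fun p : ℕ → Plane => finConfig p I := by
  refine measurable_config_iff.2 fun A hA => ?_
  have : (fun p : ℕ → Plane => ((finConfig p I).carrier ∩ A).encard) = fun p =>
      {n | n ∈ (I : Set ℕ) ∧ p n ∈ A ∧ ∀ m, m < n → m ∈ (I : Set ℕ) → p m ≠ p n}.encard :=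
    funext fun p => encard_image_inter p I A
  rw [this]
  refine measurable_encard_setOf fun n => ?_
  have h1 : Measurable fun p : ℕ → Plane => p n ∈ A := measurableSet_setOfPred.1 (measurable_pi_apply n hA)
  have h2 : ∀ m, Measurable fun p : ℕ → Plane => p m ≠ p n := fun m => measurableSet_setOfPred.1
    (measurableSet_eq_fun (measurable_pi_apply m) (measurable_pi_apply n)).compl
  exact measurableSet_setOfPred.2 <| measurable_const.and <| h1.and <| Measurable.forall fun m =>
    measurable_const.imp <| measurable_const.imp (h2 m)

/-- The sequences of distinct points with a locally finite range. -/
def goodSeq : Set (ℕ → Plane) := {p | Function.Injective p ∧ LocFinite (Set.range p)}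

theorem locFinite_range_iff {p : ℕ → Plane} (hp : Function.Injective p) :
    LocFinite (Set.range p) ↔ ∀ r : ℕ, {n | ‖p n‖ ≤ r}.Finite := by
  constructor
  · intro h r
    have := (h (Metric.closedBall 0 r) Metric.isBounded_closedBall).preimage (f := p) hp.injOn
    refine this.subset fun n hn => ⟨⟨n, rfl⟩, by simpa using hn⟩
  · intro h K hK
    obtain ⟨R, hR⟩ := hK.subset_closedBall 0
    obtain ⟨r, hr⟩ := exists_nat_ge R
    refine ((h r).image p).subset ?_
    rintro _ ⟨⟨n, rfl⟩, hn⟩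
    have := hR hn
    simp only [Metric.mem_closedBall, dist_zero_right] at this
    exact ⟨n, this.trans hr, rfl⟩

theorem measurableSet_goodSeq : MeasurableSet goodSeq := by
  have : goodSeq = {p : ℕ → Plane | ∀ i j, p i = p j → i = j} ∩
      {p : ℕ → Plane | ∀ r : ℕ, {n | ‖p n‖ ≤ r}.encard ≠ ⊤} := by
    ext p
    simp only [Set.encard_ne_top_iff]
    constructor
    · rintro ⟨h1, h2⟩
      exact ⟨fun i j h => h1 h, (locFinite_range_iff h1).1 h2⟩
    · rintro ⟨h1, h2⟩
      have h1' : Function.Injective p := fun i j h => h1 i j h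
      exact ⟨h1', (locFinite_range_iff h1').2 h2⟩
  rw [this]
  refine MeasurableSet.inter ?_ ?_
  · refine measurableSet_setOfPred.2 <| Measurable.forall fun i => Measurable.forall fun j =>
      Measurable.imp (measurableSet_setOfPred.1 ?_) measurable_const
    exact measurableSet_eq_fun (measurable_pi_apply i) (measurable_pi_apply j)
  · refine measurableSet_setOfPred.2 <| Measurable.forall fun r => measurableSet_setOfPred.1 ?_
    have hm : Measurable fun p : ℕ → Plane => {n | ‖p n‖ ≤ r}.encard :=
      measurable_encard_setOf fun n =>
        measurableSet_le (measurable_pi_apply n).norm measurable_const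
    exact hm (MeasurableSet.of_discrete (s := {⊤}ᶜ))

theorem mkColored_ofColor {p : ℕ → Plane} (hp : p ∈ goodSeq) (c : ℕ → ℤˣ) (e : ℤˣ) :
    (mkColored p c).ofColor e = p '' {n | c n = e} := by
  have hp' : Function.Injective p ∧ LocFinite (Set.range p) := hp
  rw [mkColored, dif_pos hp']
  ext y
  simp only [ColConfig.ofColor, Set.mem_ofPred_eq, Set.mem_image]
  constructor
  · rintro ⟨⟨n, rfl⟩, hn⟩
    refine ⟨n, ?_, rfl⟩
    rwa [Equiv.ofInjective_symm_apply] at hn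
  · rintro ⟨n, hn, rfl⟩
    refine ⟨⟨n, rfl⟩, ?_⟩
    rwa [Equiv.ofInjective_symm_apply]

theorem mkColored_pts {p : ℕ → Plane} (hp : p ∈ goodSeq) (c : ℕ → ℤˣ) :
    (mkColored p c).pts = ⟨Set.range p, hp.2⟩ := by
  have hp' : Function.Injective p ∧ LocFinite (Set.range p) := hp
  rw [mkColored, dif_pos hp']

theorem mkColored_of_not_mem {p : ℕ → Plane} (hp : p ∉ goodSeq) (c : ℕ → ℤˣ) :
    mkColored p c = ⟨⟨∅, LocFinite.of_finite Set.finite_empty⟩, fun _ => 1⟩ := by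
  have hp' : ¬ (Function.Injective p ∧ LocFinite (Set.range p)) := hp
  rw [mkColored, dif_neg hp']

theorem measurable_mkColored :
    Measurable fun q : (ℕ → Plane) × (ℕ → ℤˣ) => mkColored q.1 q.2 := by
  refine measurable_colConfig_iff.2 fun e A hA => ?_
  have hG : MeasurableSet {q : (ℕ → Plane) × (ℕ → ℤˣ) | q.1 ∈ goodSeq} :=
    measurable_fst measurableSet_goodSeq
  have : (fun q : (ℕ → Plane) × (ℕ → ℤˣ) => ((mkColored q.1 q.2).ofColor e ∩ A).encard) =
      fun q => {n | q.1 ∈ goodSeq ∧ q.2 n = e ∧ q.1 n ∈ A}.encard := by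
    funext q
    by_cases hq : q.1 ∈ goodSeq
    · rw [mkColored_ofColor hq, ← Set.image_inter_preimage, hq.1.encard_image]
      simp only [hq, true_and]
      rfl
    · rw [mkColored_of_not_mem hq]
      simp [ColConfig.ofColor, hq]
  rw [this]
  refine measurable_encard_setOf fun n => hG.inter (MeasurableSet.inter ?_ ?_)
  · have hm : Measurable fun q : (ℕ → Plane) × (ℕ → ℤˣ) => q.2 n := by fun_prop
    exact hm (measurableSet_singleton e)
  · have hm : Measurable fun q : (ℕ → Plane) × (ℕ → ℤˣ) => q.1 n := by fun_prop
    exact hm hA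

/-! ### Sorting sequences of real numbers -/

section Sorting

variable {u : ℕ → ℝ} {I : Set ℕ}

/-- The rank of a term turns its value into counts: this equivalence lets `orderStat` recover the
value from counts at rational levels. -/
theorem succ_le_encard_le_iff {n m : ℕ} (hn : n ∈ I)
    (hm : {k | k ∈ I ∧ u k < u n}.encard = m) (q : ℝ) :
    ((m + 1 : ℕ) : ℕ∞) ≤ {k | k ∈ I ∧ u k ≤ q}.encard ↔ u n ≤ q := by
  constructor
  · intro h
    by_contra! hq
    have : {k | k ∈ I ∧ u k ≤ q} ⊆ {k | k ∈ I ∧ u k < u n} :=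
      fun k hk => ⟨hk.1, hk.2.trans_lt hq⟩
    have h2 := h.trans (Set.encard_le_encard this)
    rw [hm] at h2
    exact absurd (Nat.cast_le.1 h2) (by omega)
  · intro h
    have : insert n {k | k ∈ I ∧ u k < u n} ⊆ {k | k ∈ I ∧ u k ≤ q} := by
      rintro k (rfl | hk)
      · exact ⟨hn, h⟩
      · exact ⟨hk.1, hk.2.le.trans h⟩
    refine le_trans (le_of_eq ?_) (Set.encard_le_encard this)
    rw [Set.encard_insert_of_notMem (fun h => lt_irrefl _ h.2), hm]
    simp

theorem encard_lt_injOn (hu : Function.Injective u) (hfin : ∀ q, {k | k ∈ I ∧ u k ≤ q}.Finite) :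
    Set.InjOn (fun n => {k | k ∈ I ∧ u k < u n}.encard) I := by
  have key : ∀ n ∈ I, ∀ m ∈ I, u n < u m →
      {k | k ∈ I ∧ u k < u n}.encard ≠ {k | k ∈ I ∧ u k < u m}.encard := by
    intro n hn m _ hlt
    refine (Set.Finite.encard_lt_encard ?_ ?_).ne
    · exact (hfin (u n)).subset fun k hk => ⟨hk.1, hk.2.le⟩
    · refine ⟨fun k hk => ⟨hk.1, hk.2.trans hlt⟩, fun h => ?_⟩
      exact lt_irrefl _ (h ⟨hn, hlt⟩).2
  intro n hn m hm h
  rcases lt_trichotomy (u n) (u m) with hlt | heq | hlt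
  · exact absurd h (key n hn m hm hlt)
  · exact hu heq
  · exact absurd h.symm (key m hm n hn hlt)

theorem exists_perm_sort_finset (hu : Function.Injective u) (I : Finset ℕ) :
    ∃ π : Equiv.Perm ℕ, (∀ m, π m ∈ I ↔ m < I.card) ∧
      ∀ m < I.card, {k | k ∈ (I : Set ℕ) ∧ u k < u (π m)}.encard = m := by
  have hfin : ∀ q, {k | k ∈ (I : Set ℕ) ∧ u k ≤ q}.Finite :=
    fun q => I.finite_toSet.subset fun k hk => hk.1
  have hfin' : ∀ n, {k | k ∈ (I : Set ℕ) ∧ u k < u n}.Finite :=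
    fun q => I.finite_toSet.subset fun k hk => hk.1
  have hlt : ∀ n : {n // n ∈ I}, {k | k ∈ (I : Set ℕ) ∧ u k < u n}.ncard < I.card := by
    intro n
    rw [← Set.ncard_coe_finset]
    refine Set.ncard_lt_ncard ⟨fun k hk => hk.1, fun h => ?_⟩ I.finite_toSet
    exact lt_irrefl _ (h n.2).2
  let f : {n // n ∈ I} → {m // m < I.card} := fun n => ⟨_, hlt n⟩
  have hfinj : Function.Injective f := by
    intro n m h
    have h' : {k | k ∈ (I : Set ℕ) ∧ u k < u n}.ncard = {k | k ∈ (I : Set ℕ) ∧ u k < u m}.ncard :=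
      congrArg Subtype.val h
    refine Subtype.ext (encard_lt_injOn hu hfin n.2 m.2 ?_)
    simp only
    rw [← (hfin' n).cast_ncard_eq, ← (hfin' m).cast_ncard_eq, h']
  have : Fintype {m // m < I.card} := Fintype.subtype (Finset.range I.card) (by simp)
  have hfbij : Function.Bijective f := by
    rw [Fintype.bijective_iff_injective_and_card]
    refine ⟨hfinj, ?_⟩
    rw [Fintype.card_coe, Fintype.card_of_subtype (Finset.range I.card) (by simp),
      Finset.card_range]
  have : Infinite {n // ¬ n ∈ I} := I.finite_toSet.infinite_compl.to_subtype
  have : Infinite {m // ¬ m < I.card} := (Set.finite_lt_nat I.card).infinite_compl.to_subtype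
  -- Off `I` the permutation is arbitrary; both complements are countably infinite, so some
  -- bijection exists.
  obtain ⟨g⟩ := nonempty_equiv_of_countable (α := {n // ¬ n ∈ I}) (β := {m // ¬ m < I.card})
  let σ : Equiv.Perm ℕ := Equiv.subtypeCongr (Equiv.ofBijective f hfbij) g
  have hσ : ∀ n (hn : n ∈ I), σ n = {k | k ∈ (I : Set ℕ) ∧ u k < u n}.ncard := by
    intro n hn
    simp [σ, Equiv.subtypeCongr, Equiv.sumCompl_symm_apply_of_pos, hn, f]
  have hσ' : ∀ n, n ∉ I → ¬ σ n < I.card := by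
    intro n hn
    have : σ n = g ⟨n, hn⟩ := by
      simp [σ, Equiv.subtypeCongr, Equiv.sumCompl_symm_apply_of_neg, hn]
    rw [this]
    exact (g ⟨n, hn⟩).2
  have hmem : ∀ m, σ.symm m ∈ I ↔ m < I.card := by
    intro m
    constructor
    · intro h
      have := hlt ⟨_, h⟩
      rw [← hσ _ h] at this
      simpa using this
    · intro h
      by_contra hn
      have := hσ' _ hn
      simp [h] at this
  refine ⟨σ.symm, hmem, fun m hm => ?_⟩
  have := hσ _ ((hmem m).2 hm)
  rw [Equiv.apply_symm_apply] at this
  rw [← (hfin' _).cast_ncard_eq, ← this]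

theorem exists_perm_sort (hu : Function.Injective u) (hfin : ∀ q, {k | u k ≤ q}.Finite) :
    ∃ π : Equiv.Perm ℕ, ∀ m, {k | k ∈ Set.univ ∧ u k < u (π m)}.encard = m := by
  have hfin' : ∀ n, {k | k ∈ Set.univ ∧ u k < u n}.Finite :=
    fun n => (hfin (u n)).subset fun k hk => hk.2.le
  let r : ℕ → ℕ := fun n => {k | k ∈ Set.univ ∧ u k < u n}.ncard
  have hr : ∀ n, {k | k ∈ Set.univ ∧ u k < u n}.encard = r n :=
    fun n => ((hfin' n).cast_ncard_eq).symm
  have hinj : Function.Injective r := by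
    intro n m h
    refine encard_lt_injOn (I := Set.univ) hu (fun q => by simpa using hfin q)
      (Set.mem_univ n) (Set.mem_univ m) ?_
    simp only [hr, h]
  have hdown : ∀ n, ∀ m < r n, ∃ k, r k = m := by
    intro n m hm
    -- The terms strictly below `u n` form a finite set whose ranks fill 0, …, r n - 1, so the range
    -- of `r` is downward closed. Being also infinite, it is everything.
    let J := (hfin' n).toFinset
    have hJ : J.card = r n := (Set.ncard_eq_toFinset_card _ (hfin' n)).symm
    obtain ⟨π, h1, h2⟩ := exists_perm_sort_finset hu J
    refine ⟨π m, ?_⟩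
    have hmJ : m < J.card := hJ ▸ hm
    have h3 := h2 m hmJ
    have hmem : u (π m) < u n := by simpa [J] using (h1 m).2 hmJ
    have : {k | k ∈ Set.univ ∧ u k < u (π m)} = {k | k ∈ (J : Set ℕ) ∧ u k < u (π m)} := by
      ext k
      simp only [Set.mem_univ, true_and, Set.mem_ofPred_eq, J, Set.Finite.coe_toFinset]
      exact ⟨fun h => ⟨h.trans hmem, h⟩, fun h => h.2⟩
    rw [← this, hr] at h3
    exact_mod_cast h3
  have hsurj : Function.Surjective r := by
    intro m
    have hinf : (Set.range r).Infinite := Set.infinite_range_of_injective hinj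
    obtain ⟨_, ⟨n, rfl⟩, hn⟩ := hinf.exists_gt m
    exact hdown n m hn
  refine ⟨(Equiv.ofBijective r ⟨hinj, hsurj⟩).symm, fun m => ?_⟩
  rw [hr]
  congr 1
  exact (Equiv.ofBijective r ⟨hinj, hsurj⟩).apply_symm_apply m

end Sorting

/-- The map `N ↦ 2 ^ (-N)`, with `2 ^ (-∞) = 0`. -/
noncomputable def halfPow (N : ℕ∞) : ℝ := if N = ⊤ then 0 else (1 / 2) ^ N.toNat

theorem halfPow_le_iff (N : ℕ∞) (m : ℕ) : halfPow N ≤ (1 / 2) ^ m ↔ (m : ℕ∞) ≤ N := by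
  induction N using ENat.recTopCoe with
  | top => simp [halfPow]
  | coe k =>
    rw [halfPow, if_neg (ENat.natCast_ne_top k), ENat.toNat_natCast, Nat.cast_le]
    exact pow_le_pow_iff_right_of_lt_one₀ (by norm_num) (by norm_num)

theorem measurable_halfPow : Measurable halfPow := measurable_from_top

/-- Recovers the `m`-th point in increasing order of a random set of real numbers from the
numbers `w q = 2 ^ (-N q)`, where `N q` is the number of points up to `q`. -/
noncomputable def orderStat (w : ℚ → ℝ) (m : ℕ) : ℝ :=
  (⨅ q : ℚ, if w q ≤ (1 / 2) ^ (m + 1) then ((q : ℝ) : EReal) else ⊤).toReal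

theorem measurable_orderStat : Measurable orderStat := by
  refine measurable_pi_lambda _ fun m => ?_
  refine Measurable.ereal_toReal (Measurable.iInf fun q => ?_)
  exact Measurable.ite (measurableSet_le (measurable_pi_apply q) measurable_const)
    measurable_const measurable_const

theorem orderStat_eq {w : ℚ → ℝ} {m : ℕ} {v : ℝ}
    (h : ∀ q : ℚ, w q ≤ (1 / 2) ^ (m + 1) ↔ v ≤ q) : orderStat w m = v := by
  have : (⨅ q : ℚ, if w q ≤ (1 / 2) ^ (m + 1) then ((q : ℝ) : EReal) else ⊤) = (v : EReal) := by
    refine le_antisymm ?_ (le_iInf fun q => ?_)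
    · by_contra! hlt
      obtain ⟨q, hq1, hq2⟩ := EReal.exists_rat_btwn_of_lt hlt
      have hle := iInf_le (fun q : ℚ => if w q ≤ (1 / 2) ^ (m + 1) then ((q : ℝ) : EReal) else ⊤) q
      simp only [if_pos ((h q).2 (by exact_mod_cast hq1.le))] at hle
      exact absurd hle (not_le.2 hq2)
    · split_ifs with hq
      · exact_mod_cast (h q).1 hq
      · exact le_top
  rw [orderStat, this, EReal.toReal_coe]

/-! ### Multiplicative functionals of sequences -/

section ProdFn

variable {E : Type*}

/-- The product `∏ₙ g (y n)`, for a function `g` with values in `[0, 1]`. -/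
noncomputable def prodFn (g : E → ℝ≥0∞) (y : ℕ → E) : ℝ≥0∞ :=
  ⨅ N : ℕ, ∏ n ∈ Finset.range N, g (y n)

variable {g g' : E → ℝ≥0∞} {y : ℕ → E}

theorem antitone_prod_range (hg : ∀ e, g e ≤ 1) (y : ℕ → E) :
    Antitone fun N : ℕ => ∏ n ∈ Finset.range N, g (y n) :=
  antitone_nat_of_succ_le fun N => by
    rw [Finset.prod_range_succ]
    exact mul_le_of_le_one_right' (hg _)

theorem tendsto_prodFn (hg : ∀ e, g e ≤ 1) (y : ℕ → E) :
    Tendsto (fun N : ℕ => ∏ n ∈ Finset.range N, g (y n)) atTop (𝓝 (prodFn g y)) :=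
  tendsto_atTop_iInf (antitone_prod_range hg y)

theorem prodFn_le_one (g : E → ℝ≥0∞) (y : ℕ → E) : prodFn g y ≤ 1 :=
  (iInf_le _ 0).trans (by simp)

theorem prodFn_ne_top (g : E → ℝ≥0∞) (y : ℕ → E) : prodFn g y ≠ ∞ :=
  ((prodFn_le_one g y).trans_lt ENNReal.one_lt_top).ne

theorem prodFn_one : prodFn (fun _ : E => 1) y = 1 := by simp [prodFn]

theorem prodFn_mul (hg : ∀ e, g e ≤ 1) (hg' : ∀ e, g' e ≤ 1) :
    prodFn (fun e => g e * g' e) y = prodFn g y * prodFn g' y := by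
  refine tendsto_nhds_unique (tendsto_prodFn (fun e => mul_le_one' (hg e) (hg' e)) y) ?_
  simp_rw [Finset.prod_mul_distrib]
  exact ENNReal.Tendsto.mul (tendsto_prodFn hg y) (.inr (prodFn_ne_top _ _))
    (tendsto_prodFn hg' y) (.inr (prodFn_ne_top _ _))

theorem measurable_prodFn [MeasurableSpace E] (hg : Measurable g) : Measurable (prodFn g) :=
  Measurable.iInf fun _ => Finset.measurable_fun_prod _ fun n _ => hg.comp (measurable_pi_apply n)

theorem prodFn_eq_of_forall_ge {N : ℕ} (hN : ∀ n, N ≤ n → g (y n) = 1) (hg : ∀ e, g e ≤ 1) :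
    prodFn g y = ∏ n ∈ Finset.range N, g (y n) := by
  refine le_antisymm (iInf_le _ N) (le_iInf fun M => ?_)
  rcases le_total M N with h | h
  · exact antitone_prod_range hg y h
  · obtain ⟨k, rfl⟩ := Nat.exists_eq_add_of_le h
    rw [Finset.prod_range_add]
    simp [hN]

theorem prodFn_indicator_of_finite {C : Set E} [DecidablePred (· ∈ C)] {a : ℝ≥0∞} (ha : a ≤ 1)
    (hfin : {n | y n ∈ C}.Finite) :
    prodFn (fun e => if e ∈ C then a else 1) y = a ^ {n | y n ∈ C}.ncard := by
  obtain ⟨N, hN⟩ := hfin.bddAbove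
  rw [prodFn_eq_of_forall_ge (N := N + 1)]
  · rw [Finset.prod_ite, Finset.prod_const, Finset.prod_const_one, mul_one,
      ← Set.ncard_coe_finset]
    congr 2
    ext n
    simp only [Set.mem_ofPred_eq, Finset.coe_filter, Finset.mem_range]
    exact ⟨fun h => h.2, fun h => ⟨Nat.lt_succ_of_le (hN h), h⟩⟩
  · intro n hn
    rw [if_neg]
    intro h
    have := hN h
    omega
  · intro e
    split_ifs <;> simp [ha]

open Classical in
-- A multiplicative functional with values 1/2 and 1 reads off a count. If the count is infinite,
-- the partial products fall below every power of 1/2, in agreement with `halfPow ⊤ = 0`.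
theorem prodFn_indicator (C : Set E) (y : ℕ → E) :
    prodFn (fun e => if e ∈ C then 2⁻¹ else 1) y = ENNReal.ofReal (halfPow {n | y n ∈ C}.encard) := by
  by_cases hfin : {n | y n ∈ C}.Finite
  · rw [prodFn_indicator_of_finite (by simp) hfin, halfPow,
      if_neg (Set.encard_ne_top_iff.2 hfin), ENNReal.ofReal_pow (by norm_num)]
    congr 1
    rw [one_div, ENNReal.ofReal_inv_of_pos (by norm_num)]
    simp
  · rw [Set.encard_eq_top hfin, halfPow, if_pos rfl, ENNReal.ofReal_zero]
    rw [prodFn, iInf_eq_bot.2 _]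
    · rfl
    intro b hb
    obtain ⟨k, hk⟩ := ENNReal.exists_inv_two_pow_lt hb.ne'
    obtain ⟨t, ht, htk⟩ := Set.Infinite.exists_subset_card_eq hfin k
    refine ⟨t.sup id + 1, lt_of_le_of_lt ?_ hk⟩
    rw [Finset.prod_ite, Finset.prod_const, Finset.prod_const_one, mul_one]
    refine pow_le_pow_right_of_le_one' (by simp) ?_
    rw [← htk]
    refine Finset.card_le_card fun n hn => ?_
    rw [Finset.mem_filter, Finset.mem_range]
    exact ⟨Nat.lt_succ_of_le (Finset.le_sup (f := id) hn), ht hn⟩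

theorem prodFn_finset_prod {ι : Type*} (t : Finset ι) (f : ι → E → ℝ≥0∞)
    (hf : ∀ i e, f i e ≤ 1) :
    prodFn (fun e => ∏ i ∈ t, f i e) y = ∏ i ∈ t, prodFn (f i) y := by
  classical
  induction t using Finset.induction_on with
  | empty => simp [prodFn_one]
  | insert i t hi ih =>
    simp_rw [Finset.prod_insert hi]
    rw [prodFn_mul (hf i) (fun e => Finset.prod_le_one' fun j _ => hf j e), ih]

end ProdFn

/-! ### Random sequences are determined up to relabelling by their multiplicative functionals -/

section Uniqueness

variable {E : Type*} [MeasurableSpace E]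

theorem halfPow_mem_Icc (N : ℕ∞) : halfPow N ∈ Set.Icc (0 : ℝ) 1 := by
  rw [halfPow]
  split_ifs
  · simp
  · exact ⟨by positivity, pow_le_one₀ (by norm_num) (by norm_num)⟩

theorem halfPow_pos_iff (N : ℕ∞) : 0 < halfPow N ↔ N ≠ ⊤ := by
  rw [halfPow]
  split_ifs with h
  · simp [h]
  · simp [h]

/-- The numbers `2 ^ (-N q)`, where `N q` counts the terms of the sequence with `ψ ≤ q`. -/
noncomputable def countSeq (ψ : E → ℝ) (y : ℕ → E) (q : ℚ) : Set.Icc (0 : ℝ) 1 :=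
  ⟨halfPow {n | ψ (y n) ≤ q}.encard, halfPow_mem_Icc _⟩

theorem measurable_countSeq {ψ : E → ℝ} (hψ : Measurable ψ) : Measurable (countSeq ψ) := by
  refine measurable_pi_lambda _ fun q => Measurable.subtype_mk ?_
  exact measurable_halfPow.comp <| measurable_encard_setOf fun n =>
    measurableSet_le (hψ.comp (measurable_pi_apply n)) measurable_const

/-- A Stone–Weierstrass argument on the compact cube. Multiplicative functionals are closed under
products, so the algebra they generate is their linear span, on which the two integrals agree; the
coordinates belong to it and separate points. -/
theorem map_countSeq_eq {ψ : E → ℝ} (hψ : Measurable ψ) {m m' : Measure (ℕ → E)}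
    [IsProbabilityMeasure m] [IsProbabilityMeasure m']
    (hmm : ∀ g : E → ℝ≥0∞, Measurable g → (∀ e, g e ≤ 1) →
      ∫⁻ y, prodFn g y ∂m = ∫⁻ y, prodFn g y ∂m') :
    m.map (countSeq ψ) = m'.map (countSeq ψ) := by
  have hw := measurable_countSeq hψ
  have : IsProbabilityMeasure (m.map (countSeq ψ)) :=
    Measure.isProbabilityMeasure_map hw.aemeasurable
  have : IsProbabilityMeasure (m'.map (countSeq ψ)) :=
    Measure.isProbabilityMeasure_map hw.aemeasurable
  let S : Submonoid (BoundedContinuousFunction (ℚ → Set.Icc (0 : ℝ) 1) ℝ) :=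
    { carrier := {f | ∃ g : E → ℝ≥0∞, Measurable g ∧ (∀ e, g e ≤ 1) ∧
        ∀ y, f (countSeq ψ y) = (prodFn g y).toReal}
      one_mem' := ⟨fun _ => 1, measurable_const, fun _ => le_rfl, fun y => by simp [prodFn_one]⟩
      mul_mem' := by
        rintro f f' ⟨g, h1, h2, h3⟩ ⟨g', h1', h2', h3'⟩
        refine ⟨fun e => g e * g' e, h1.mul h1', fun e => mul_le_one' (h2 e) (h2' e), fun y => ?_⟩
        rw [prodFn_mul h2 h2', ENNReal.toReal_mul, BoundedContinuousFunction.mul_apply, h3, h3'] }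
  let A : StarSubalgebra ℝ (BoundedContinuousFunction (ℚ → Set.Icc (0 : ℝ) 1) ℝ) :=
    { Algebra.adjoin ℝ (S : Set _) with
      star_mem' := by
        intro a ha
        have : star a = a := by ext x; simp
        rw [this]
        exact ha }
  refine ext_of_forall_mem_subalgebra_integral_eq_of_polish (𝕜 := ℝ) (A := A) ?_ ?_
  · intro v v' hvv
    obtain ⟨q, hq⟩ := Function.ne_iff.1 hvv
    let f : BoundedContinuousFunction (ℚ → Set.Icc (0 : ℝ) 1) ℝ :=
      BoundedContinuousFunction.mkOfCompact ⟨fun v => (v q : ℝ), by fun_prop⟩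
    have hf : f ∈ A := by
      refine Algebra.subset_adjoin ?_
      classical
      -- The coordinate at `q` is the multiplicative functional with factor 1/2 on the sublevel set
      -- of `ψ`.
      refine ⟨fun e => if e ∈ {e | ψ e ≤ q} then 2⁻¹ else 1, ?_, ?_, ?_⟩
      · exact Measurable.ite (measurableSet_le hψ measurable_const) measurable_const
          measurable_const
      · intro e
        dsimp only
        split_ifs <;> simp
      · intro y
        rw [prodFn_indicator, ENNReal.toReal_ofReal (halfPow_mem_Icc _).1]
        rfl
    refine ⟨f, ⟨_, ⟨f, hf, rfl⟩, rfl⟩, ?_⟩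
    simpa [f, Subtype.ext_iff] using hq
  · intro f hf
    have hf' : f ∈ Submodule.span ℝ (S : Set _) := by
      have h1 : f ∈ (Algebra.adjoin ℝ (S : Set _)).toSubmodule := hf
      rwa [Algebra.adjoin_eq_span, Submonoid.closure_eq] at h1
    clear hf
    induction hf' using Submodule.span_induction with
    | mem f hf =>
      obtain ⟨g, h1, h2, h3⟩ := hf
      rw [integral_map hw.aemeasurable (by fun_prop), integral_map hw.aemeasurable (by fun_prop)]
      simp_rw [h3]
      rw [integral_toReal (measurable_prodFn h1).aemeasurable
          (.of_forall fun y => (prodFn_ne_top g y).lt_top),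
        integral_toReal (measurable_prodFn h1).aemeasurable
          (.of_forall fun y => (prodFn_ne_top g y).lt_top), hmm g h1 h2]
    | zero => simp
    | add f f' _ _ hf hf' =>
      simp only [BoundedContinuousFunction.coe_add, Pi.add_apply]
      rw [integral_add (f.integrable _) (f'.integrable _),
        integral_add (f.integrable _) (f'.integrable _), hf, hf']
    | smul c f _ hf =>
      simp only [BoundedContinuousFunction.coe_smul, integral_smul, hf]

/-- If two random sequences of distinct points, with finitely many points where `ψ ≤ q` for every
`q`, have the same multiplicative functionals, then the expectations of the functionals that are
invariant under relabelling agree. -/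
theorem lintegral_eq_of_prodFn_eq [StandardBorelSpace E] {ψ : E → ℝ} (hψ : Measurable ψ)
    (hψ_inj : Function.Injective ψ) {m m' : Measure (ℕ → E)}
    [IsProbabilityMeasure m] [IsProbabilityMeasure m']
    (hmm : ∀ g : E → ℝ≥0∞, Measurable g → (∀ e, g e ≤ 1) →
      ∫⁻ y, prodFn g y ∂m = ∫⁻ y, prodFn g y ∂m')
    (hinj : ∀ᵐ y ∂m, Function.Injective y) (hinj' : ∀ᵐ y ∂m', Function.Injective y)
    (hfin : ∀ᵐ y ∂m, ∀ q : ℝ, {n | ψ (y n) ≤ q}.Finite)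
    {Φ : (ℕ → E) → ℝ≥0∞} (hΦ : Measurable Φ)
    (hΦ_perm : ∀ (π : Equiv.Perm ℕ) (y : ℕ → E), Φ (y ∘ π) = Φ y) :
    ∫⁻ y, Φ y ∂m = ∫⁻ y, Φ y ∂m' := by
  have hw := measurable_countSeq hψ
  have hmap := map_countSeq_eq hψ hmm
  -- Finiteness of all the counts says that all coordinates of `countSeq` are positive, an event
  -- that depends only on the common law; so it passes from `m` to `m'`.
  have hfin' : ∀ᵐ y ∂m', ∀ q : ℝ, {n | ψ (y n) ≤ q}.Finite := by
    have hmeas : MeasurableSet {w : ℚ → Set.Icc (0 : ℝ) 1 | ∀ q, 0 < (w q : ℝ)} := by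
      refine measurableSet_setOfPred.2 <| Measurable.forall fun q => measurableSet_setOfPred.1 ?_
      exact measurableSet_lt measurable_const (by fun_prop)
    have h1 : ∀ᵐ w ∂(m.map (countSeq ψ)), ∀ q, 0 < (w q : ℝ) := by
      rw [ae_map_iff hw.aemeasurable hmeas]
      filter_upwards [hfin] with y hy q
      exact (halfPow_pos_iff _).2 (Set.encard_ne_top_iff.2 (hy q))
    rw [hmap, ae_map_iff hw.aemeasurable hmeas] at h1
    filter_upwards [h1] with y hy q
    obtain ⟨r, hr⟩ := exists_rat_gt q
    exact (Set.encard_ne_top_iff.1 ((halfPow_pos_iff _).1 (hy r))).subset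
      fun n (hn : ψ (y n) ≤ q) => hn.trans hr.le
  have hemb : MeasurableEmbedding ψ := hψ.measurableEmbedding hψ_inj
  have hne : Nonempty E := by
    have : Nonempty (ℕ → E) := nonempty_of_isProbabilityMeasure m
    exact this.map fun y => y 0
  obtain ⟨ψinv, hψinv, hψinv'⟩ := hemb.exists_measurable_extend measurable_id fun _ => hne
  -- `F` evaluates `Φ` at the sorted sequence rebuilt from the counts. Invariance under permutations
  -- makes this equal to `Φ` at the original sequence.
  let F : (ℚ → Set.Icc (0 : ℝ) 1) → ℝ≥0∞ := fun w =>
    Φ fun k => ψinv (orderStat (fun q => (w q : ℝ)) k)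
  have hF : Measurable F := by
    refine hΦ.comp (measurable_pi_lambda _ fun k => hψinv.comp ?_)
    refine (measurable_pi_apply k).comp (measurable_orderStat.comp ?_)
    fun_prop
  have key : ∀ y : ℕ → E, Function.Injective y → (∀ q : ℝ, {n | ψ (y n) ≤ q}.Finite) →
      Φ y = F (countSeq ψ y) := by
    intro y hy hyf
    obtain ⟨π, hπ⟩ := exists_perm_sort (hψ_inj.comp hy) hyf
    rw [← hΦ_perm π y]
    change _ = Φ _
    congr 1
    funext k
    have : orderStat (fun q => (countSeq ψ y q : ℝ)) k = ψ (y (π k)) := by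
      refine orderStat_eq fun q => ?_
      have := succ_le_encard_le_iff (Set.mem_univ _) (hπ k) q
      simp only [Set.mem_univ, true_and, Function.comp_apply] at this
      rw [← this]
      exact halfPow_le_iff _ _
    rw [this]
    exact (congrFun hψinv' _).symm
  have h1 : ∫⁻ y, Φ y ∂m = ∫⁻ w, F w ∂(m.map (countSeq ψ)) := by
    rw [lintegral_map hF hw]
    refine lintegral_congr_ae ?_
    filter_upwards [hinj, hfin] with y h1 h2 using key y h1 h2
  have h2 : ∫⁻ y, Φ y ∂m' = ∫⁻ w, F w ∂(m'.map (countSeq ψ)) := by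
    rw [lintegral_map hF hw]
    refine lintegral_congr_ae ?_
    filter_upwards [hinj', hfin'] with y h1 h2 using key y h1 h2
  rw [h1, h2, hmap]

end Uniqueness

/-! ### Poisson processes -/

theorem lintegral_pow_poissonMeasure (r : ℝ≥0) {a : ℝ≥0∞} (ha : a ≠ ∞) :
    ∫⁻ n, a ^ n ∂(poissonMeasure r) = ENNReal.ofReal (Real.exp (r * (a.toReal - 1))) := by
  lift a to ℝ≥0 using ha
  rw [lintegral_countable']
  have h1 : ∀ n : ℕ, (a : ℝ≥0∞) ^ n * poissonMeasure r {n} =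
      ENNReal.ofReal (Real.exp (-r) * ((r * a) ^ n / n.factorial)) := by
    intro n
    rw [poissonMeasure_singleton, ← ENNReal.ofReal_coe_nnreal (p := a),
      ← ENNReal.ofReal_pow a.coe_nonneg, ← ENNReal.ofReal_mul (by positivity)]
    congr 1
    rw [mul_pow]
    ring
  simp_rw [h1]
  have hs : Summable fun n : ℕ => ((r : ℝ) * a) ^ n / n.factorial := Real.summable_pow_div_factorial _
  rw [← ENNReal.ofReal_tsum_of_nonneg (fun n => by positivity) (hs.mul_left _), tsum_mul_left]
  have h2 : ∑' n : ℕ, ((r : ℝ) * a) ^ n / n.factorial = Real.exp (r * a) := by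
    rw [Real.exp_eq_exp_ℝ, NormedSpace.exp_eq_tsum_div]
  rw [h2, ← Real.exp_add]
  congr 2
  simp
  ring

section Poisson

variable {Ω₀ : Type*} [MeasurableSpace Ω₀] {P : Measure Ω₀} {x : Ω₀ → ℕ → Plane}

theorem measurable_encard_range_inter (hx : Measurable x) {A : Set Plane} (hA : MeasurableSet A) :
    Measurable fun ω => (Set.range (x ω) ∩ A).encard := by
  have : (fun ω => (Set.range (x ω) ∩ A).encard) = fun ω =>
      {n | n ∈ Set.univ ∧ x ω n ∈ A ∧ ∀ m, m < n → m ∈ Set.univ → x ω m ≠ x ω n}.encard := by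
    funext ω
    rw [← Set.image_univ]
    exact encard_image_inter _ _ _
  rw [this]
  refine measurable_encard_setOf fun n => ?_
  have h0 : ∀ m, Measurable fun ω => x ω m := fun m => (measurable_pi_apply m).comp hx
  have h1 : Measurable fun ω => x ω n ∈ A := measurableSet_setOfPred.1 (h0 n hA)
  have h2 : ∀ m, Measurable fun ω => x ω m ≠ x ω n := fun m => measurableSet_setOfPred.1
    (measurableSet_eq_fun (h0 m) (h0 n)).compl
  exact measurableSet_setOfPred.2 <| measurable_const.and <| h1.and <| Measurable.forall fun m =>
    measurable_const.imp <| measurable_const.imp (h2 m)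

theorem IsPoissonProcess.ae_finite (hP : IsPoissonProcess P fun ω => Set.range (x ω))
    {A : Set Plane} (hA : MeasurableSet A) (hA' : volume A ≠ ∞) :
    ∀ᵐ ω ∂P, (Set.range (x ω) ∩ A).Finite := by
  have h := hP.law A hA hA'
  have h1 : ∀ᵐ k ∂(P.map fun ω => (Set.range (x ω) ∩ A).encard), k ≠ ⊤ := by
    rw [h.map_eq, ae_map_iff (by fun_prop) (MeasurableSet.of_discrete)]
    exact .of_forall fun n => ENat.natCast_ne_top n
  filter_upwards [ae_of_ae_map h.aemeasurable h1] with ω hω using Set.encard_ne_top_iff.1 hω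

theorem IsPoissonProcess.ae_locFinite (hP : IsPoissonProcess P fun ω => Set.range (x ω)) :
    ∀ᵐ ω ∂P, LocFinite (Set.range (x ω)) := by
  have : ∀ᵐ ω ∂P, ∀ r : ℕ, (Set.range (x ω) ∩ Metric.closedBall 0 r).Finite :=
    ae_all_iff.2 fun r => hP.ae_finite measurableSet_closedBall
      (isCompact_closedBall _ _).measure_lt_top.ne
  filter_upwards [this] with ω hω K hK
  obtain ⟨R, hR⟩ := hK.subset_closedBall 0
  obtain ⟨r, hr⟩ := exists_nat_ge R
  exact (hω r).subset
    (Set.inter_subset_inter_right _ (hR.trans (Metric.closedBall_subset_closedBall hr)))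

theorem IsPoissonProcess.lintegral_pow (hP : IsPoissonProcess P fun ω => Set.range (x ω))
    {A : Set Plane} (hA : MeasurableSet A) (hA' : volume A ≠ ∞) {a : ℝ≥0∞} (ha : a ≠ ∞) :
    ∫⁻ ω, a ^ (Set.range (x ω) ∩ A).ncard ∂P =
      ENNReal.ofReal (Real.exp ((volume A).toReal * (a.toReal - 1))) := by
  have h := hP.law A hA hA'
  have h1 : ∫⁻ ω, a ^ (Set.range (x ω) ∩ A).ncard ∂P =
      ∫⁻ k : ℕ∞, a ^ k.toNat ∂(P.map fun ω => (Set.range (x ω) ∩ A).encard) := by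
    rw [lintegral_map' (Measurable.aemeasurable (measurable_from_top)) h.aemeasurable]
    rfl
  rw [h1, h.map_eq, lintegral_map measurable_from_top (by fun_prop)]
  simp only [ENat.toNat_natCast]
  rw [lintegral_pow_poissonMeasure _ ha]
  rfl

theorem ncard_range_inter {y : ℕ → Plane} (hy : Function.Injective y) (A : Set Plane) :
    (Set.range y ∩ A).ncard = {n | y n ∈ A}.ncard := by
  rw [← Set.ncard_image_of_injective _ hy]
  congr 1
  ext z
  simp only [Set.mem_inter_iff, Set.mem_range, Set.mem_image, Set.mem_ofPred_eq]
  constructor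
  · rintro ⟨⟨n, rfl⟩, h⟩; exact ⟨n, h, rfl⟩
  · rintro ⟨n, h, rfl⟩; exact ⟨⟨n, rfl⟩, h⟩

/-- On the disjoint level sets of `φ` the functional is a product of powers of independent Poisson
counts, and the Poisson generating function evaluates each factor. -/
theorem IsPoissonProcess.lintegral_prodFn_simpleFunc (hx : Measurable x)
    (hinj : ∀ᵐ ω ∂P, Function.Injective (x ω))
    (hP : IsPoissonProcess P fun ω => Set.range (x ω)) (φ : SimpleFunc Plane ℝ≥0∞)
    (hφ : ∀ e, φ e ≤ 1) (hφ' : ∀ a ≠ 0, volume (φ ⁻¹' {a}) ≠ ∞) :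
    ∫⁻ ω, prodFn (fun e => 1 - φ e) (x ω) ∂P = EReal.exp (-(∫⁻ e, φ e : ℝ≥0∞)) := by
  classical
  set t := φ.range.filter (· ≠ 0) with ht
  let A : Fin t.card → Set Plane := fun j => φ ⁻¹' {(t.equivFin.symm j : ℝ≥0∞)}
  have ht0 : ∀ a : t, (a : ℝ≥0∞) ≠ 0 := fun a => (Finset.mem_filter.1 a.2).2
  have ht1 : ∀ a : t, (a : ℝ≥0∞) ≤ 1 := by
    intro a
    obtain ⟨e, he⟩ := SimpleFunc.mem_range.1 (Finset.mem_filter.1 a.2).1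
    rw [← he]
    exact hφ e
  have hA : ∀ j, MeasurableSet (A j) := fun j => φ.measurableSet_fiber _
  have hAvol : ∀ j, volume (A j) ≠ ∞ := fun j => hφ' _ (ht0 _)
  have hAdisj : Pairwise fun i j => Disjoint (A i) (A j) := by
    intro i j hij
    refine Disjoint.preimage _ (Set.disjoint_singleton.2 fun h => hij ?_)
    exact t.equivFin.symm.injective (Subtype.ext h)
  let a : Fin t.card → ℝ≥0∞ := fun j => t.equivFin.symm j
  -- At most one factor differs from 1, because the level sets are disjoint.
  have hdecomp : (fun e => 1 - φ e) =
      fun e => ∏ j : Fin t.card, if e ∈ A j then 1 - a j else 1 := by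
    funext e
    by_cases he : φ e = 0
    · rw [Finset.prod_eq_one, he, tsub_zero]
      intro j _
      rw [if_neg]
      intro hj
      exact ht0 (t.equivFin.symm j) (hj.symm.trans he)
    · have het : φ e ∈ t := Finset.mem_filter.2 ⟨φ.mem_range_self e, he⟩
      rw [Finset.prod_eq_single (t.equivFin ⟨φ e, het⟩)]
      · rw [if_pos (by simp [A])]
        simp [a]
      · intro j _ hj
        rw [if_neg]
        intro hj'
        refine hj (t.equivFin.symm.injective (Subtype.ext ?_))
        simpa using (Set.mem_preimage.1 hj').symm
      · simp
  have hae : ∀ᵐ ω ∂P, prodFn (fun e => 1 - φ e) (x ω) =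
      ∏ j : Fin t.card, (1 - a j) ^ (Set.range (x ω) ∩ A j).encard.toNat := by
    filter_upwards [hinj, ae_all_iff.2 fun j => hP.ae_finite (hA j) (hAvol j)] with ω h1 h2
    rw [hdecomp, prodFn_finset_prod]
    · refine Finset.prod_congr rfl fun j _ => ?_
      rw [prodFn_indicator_of_finite tsub_le_self, ← ncard_range_inter h1]
      · rfl
      · refine ((h2 j).preimage h1.injOn).subset fun n hn => ⟨⟨n, rfl⟩, hn⟩
    · intro j e
      split_ifs <;> simp
  rw [lintegral_congr_ae hae]
  have hind := (hP.indep t.card A hA hAdisj).comp (fun j (k : ℕ∞) => (1 - a j) ^ k.toNat)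
    fun j => measurable_from_top
  have := lintegral_prod_eq_prod_lintegral_of_indepFun Finset.univ _ hind
    fun j => measurable_from_top.comp (measurable_encard_range_inter hx (hA j))
  simp only [Function.comp_def] at this
  rw [this]
  have hone : ∀ j, ∫⁻ ω, (1 - a j) ^ (Set.range (x ω) ∩ A j).encard.toNat ∂P =
      EReal.exp (-((a j * volume (A j) : ℝ≥0∞) : EReal)) := by
    intro j
    have h1 : a j ≠ ∞ := ((ht1 _).trans_lt ENNReal.one_lt_top).ne
    have := hP.lintegral_pow (hA j) (hAvol j) (a := 1 - a j)
      (ENNReal.sub_ne_top ENNReal.one_ne_top)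
    simp only [Set.ncard] at this
    rw [this, ENNReal.toReal_sub_of_le (ht1 _) ENNReal.one_ne_top]
    have h2 : ((a j * volume (A j) : ℝ≥0∞) : EReal) =
        (((a j).toReal * (volume (A j)).toReal : ℝ) : EReal) := by
      rw [← ENNReal.toReal_mul, EReal.coe_ennreal_toReal (ENNReal.mul_ne_top h1 (hAvol j))]
    rw [h2, ← EReal.coe_neg, EReal.exp_coe]
    congr 2
    simp [a]
    ring
  simp_rw [hone]
  have hsum : ∫⁻ e, φ e = ∑ j, a j * volume (A j) := by
    rw [SimpleFunc.lintegral_eq_lintegral φ volume, SimpleFunc.lintegral,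
      ← Finset.sum_filter_of_ne (p := (· ≠ 0))]
    · rw [← ht, ← Finset.sum_coe_sort t]
      exact (Equiv.sum_comp t.equivFin.symm fun b : t => (b : ℝ≥0∞) * volume (φ ⁻¹' {(b : ℝ≥0∞)})).symm
    · intro b _ hb hb0
      simp [hb0] at hb
  rw [hsum]
  have : ∀ s : Finset (Fin t.card), ∏ j ∈ s, EReal.exp (-((a j * volume (A j) : ℝ≥0∞) : EReal)) =
      EReal.exp (-((∑ j ∈ s, a j * volume (A j) : ℝ≥0∞) : EReal)) := by
    intro s
    induction s using Finset.induction_on with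
    | empty => simp
    | insert i s hi ih =>
      rw [Finset.prod_insert hi, Finset.sum_insert hi, ih, EReal.coe_ennreal_add, EReal.neg_add,
        sub_eq_add_neg, EReal.exp_add]
      · exact .inl (EReal.coe_ennreal_ne_bot _)
      · exact .inr (EReal.coe_ennreal_ne_bot _)
  exact this Finset.univ

/-- Approximation from the simple case. The extended exponential also covers an infinite integral of
1 - g, where the value is 0. -/
theorem IsPoissonProcess.lintegral_prodFn [IsProbabilityMeasure P] (hx : Measurable x)
    (hinj : ∀ᵐ ω ∂P, Function.Injective (x ω))
    (hP : IsPoissonProcess P fun ω => Set.range (x ω)) {g : Plane → ℝ≥0∞} (hg : Measurable g)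
    (hg1 : ∀ e, g e ≤ 1) :
    ∫⁻ ω, prodFn g (x ω) ∂P = EReal.exp (-(∫⁻ e, (1 - g e) : ℝ≥0∞)) := by
  have hf : Measurable fun e => 1 - g e := measurable_const.sub hg
  -- Truncation to balls gives the non-zero level sets finite area, while the sequence still
  -- increases to 1 - g.
  let φ : ℕ → SimpleFunc Plane ℝ≥0∞ := fun m =>
    (SimpleFunc.eapprox (fun e => 1 - g e) m).restrict (Metric.closedBall 0 m)
  have hφ_apply : ∀ m e, φ m e = (Metric.closedBall 0 (m : ℝ)).indicator
      (SimpleFunc.eapprox (fun e => 1 - g e) m) e := fun m e =>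
    SimpleFunc.restrict_apply _ measurableSet_closedBall _
  have hle : ∀ m e, φ m e ≤ 1 - g e := by
    intro m e
    rw [hφ_apply]
    refine (Set.indicator_le_self _ _ _).trans ?_
    rw [← SimpleFunc.iSup_eapprox_apply hf e]
    exact le_iSup (fun m => SimpleFunc.eapprox (fun e => 1 - g e) m e) m
  have hmono : ∀ e, Monotone fun m => φ m e := by
    intro e m m' hmm
    simp only [hφ_apply]
    refine (Set.indicator_le_indicator (SimpleFunc.monotone_eapprox _ hmm e)).trans ?_
    exact Set.indicator_le_indicator_of_subset
      (Metric.closedBall_subset_closedBall (by exact_mod_cast hmm)) (fun _ => zero_le) e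
  have hlim : ∀ e, Tendsto (fun m => φ m e) atTop (𝓝 (1 - g e)) := by
    intro e
    have h1 := SimpleFunc.tendsto_eapprox hf e
    refine h1.congr' ?_
    obtain ⟨r, hr⟩ := exists_nat_ge ‖e‖
    filter_upwards [eventually_ge_atTop r] with m hm
    rw [hφ_apply, Set.indicator_of_mem]
    simpa using hr.trans (by exact_mod_cast hm)
  have hsimple : ∀ m, ∫⁻ ω, prodFn (fun e => 1 - φ m e) (x ω) ∂P =
      EReal.exp (-(∫⁻ e, φ m e : ℝ≥0∞)) := by
    intro m
    refine hP.lintegral_prodFn_simpleFunc hx hinj (φ m)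
      (fun e => (hle m e).trans tsub_le_self) fun a ha => ?_
    refine ((measure_mono ?_).trans_lt
      (isCompact_closedBall (0 : Plane) (m : ℝ)).measure_lt_top).ne
    intro e he
    by_contra hn
    refine ha ?_
    rw [← Set.mem_singleton_iff.1 he, hφ_apply, Set.indicator_of_notMem hn]
  have hsub_lim : ∀ e, Tendsto (fun m => 1 - φ m e) atTop (𝓝 (g e)) := by
    intro e
    have := ENNReal.Tendsto.sub (tendsto_const_nhds (x := (1 : ℝ≥0∞))) (hlim e)
      (.inl ENNReal.one_ne_top)
    rwa [ENNReal.sub_sub_cancel ENNReal.one_ne_top (hg1 e)] at this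
  have hsub_anti : ∀ e, Antitone fun m => 1 - φ m e :=
    fun e m m' h => tsub_le_tsub_left (hmono e h) 1
  have hpt : ∀ y : ℕ → Plane, Tendsto (fun m => prodFn (fun e => 1 - φ m e) y) atTop
      (𝓝 (prodFn g y)) := by
    intro y
    have hprod_lim : ∀ N, Tendsto (fun m => ∏ n ∈ Finset.range N, (1 - φ m (y n))) atTop
        (𝓝 (∏ n ∈ Finset.range N, g (y n))) := fun N =>
      ENNReal.tendsto_finsetProd_of_ne_top _ (fun n _ => hsub_lim (y n))
        fun n _ => ((hg1 _).trans_lt ENNReal.one_lt_top).ne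
    have hprod_anti : ∀ N, Antitone fun m => ∏ n ∈ Finset.range N, (1 - φ m (y n)) :=
      fun N m m' h => Finset.prod_le_prod' fun n _ => hsub_anti _ h
    -- The partial products decrease both in the number of factors and in `m`, so the two limits are
    -- infima and commute.
    have hiInf : prodFn g y = ⨅ m, prodFn (fun e => 1 - φ m e) y := by
      unfold prodFn
      rw [iInf_comm]
      exact iInf_congr fun N => tendsto_nhds_unique (hprod_lim N) (tendsto_atTop_iInf (hprod_anti N))
    rw [hiInf]
    exact tendsto_atTop_iInf fun m m' h => iInf_mono fun N => hprod_anti N h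
  have hlhs : Tendsto (fun m => ∫⁻ ω, prodFn (fun e => 1 - φ m e) (x ω) ∂P) atTop
      (𝓝 (∫⁻ ω, prodFn g (x ω) ∂P)) := by
    refine tendsto_lintegral_of_dominated_convergence (fun _ => 1) (fun m => ?_)
      (fun m => .of_forall fun ω => prodFn_le_one _ _) (by simp) (.of_forall fun ω => hpt _)
    exact (measurable_prodFn (measurable_const.sub (φ m).measurable)).comp hx
  have hrhs : Tendsto (fun m => EReal.exp (-((∫⁻ e, φ m e : ℝ≥0∞) : EReal))) atTop
      (𝓝 (EReal.exp (-((∫⁻ e, (1 - g e) : ℝ≥0∞) : EReal)))) := by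
    have h1 := lintegral_tendsto_of_tendsto_of_monotone (μ := (volume : Measure Plane))
      (fun m => (φ m).measurable.aemeasurable) (.of_forall hmono) (.of_forall hlim)
    refine ((ENNReal.continuous_exp.comp
      (continuous_neg.comp continuous_coe_ennreal_ereal)).tendsto _).comp h1
  simp_rw [hsimple] at hlhs
  exact tendsto_nhds_unique hlhs hrhs

/-! ### Independent displacements -/

theorem lintegral_prodFn_infinitePi {X M : Type*} [MeasurableSpace M] (μ : Measure M)
    [IsProbabilityMeasure μ] {G : X → M → ℝ≥0∞} (hG : ∀ e, Measurable (G e))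
    (hG1 : ∀ e z, G e z ≤ 1) (y : ℕ → X) :
    ∫⁻ z, prodFn (fun q : X × M => G q.1 q.2) (fun n => (y n, z n)) ∂(Measure.infinitePi fun _ => μ) =
      prodFn (fun e => ∫⁻ z, G e z ∂μ) y := by
  unfold prodFn
  have hm : ∀ n, Measurable fun z : ℕ → M => G (y n) (z n) :=
    fun n => (hG (y n)).comp (measurable_pi_apply n)
  rw [lintegral_iInf]
  · refine iInf_congr fun N => ?_
    have hind : iIndepFun (fun n (z : ℕ → M) => G (y n) (z n)) (Measure.infinitePi fun _ => μ) :=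
      iIndepFun_infinitePi (X := fun n => G (y n)) fun n => hG (y n)
    rw [lintegral_prod_eq_prod_lintegral_of_indepFun _ _ hind hm]
    refine Finset.prod_congr rfl fun n _ => ?_
    conv_rhs => rw [← Measure.infinitePi_map_eval (fun _ : ℕ => μ) n]
    beta_reduce
    rw [lintegral_map (hG _) (measurable_pi_apply n)]
  · exact fun N => Finset.measurable_fun_prod _ fun n _ => hm n
  · exact fun N N' h z => antitone_prod_range (fun q => hG1 q.1 q.2) (fun n => (y n, z n)) h
  · simp

variable {M : Type*} [MeasurableSpace M] {μ : Measure M} [IsProbabilityMeasure μ]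

/-- The marking theorem: integrating out independent marks replaces each factor by its mean, which
leaves a multiplicative functional of the Poisson process alone. -/
theorem IsPoissonProcess.lintegral_prodFn_prod [IsProbabilityMeasure P] (hx : Measurable x)
    (hinj : ∀ᵐ ω ∂P, Function.Injective (x ω))
    (hP : IsPoissonProcess P fun ω => Set.range (x ω)) {G : Plane → M → ℝ≥0∞}
    (hG : Measurable (Function.uncurry G)) (hG1 : ∀ e z, G e z ≤ 1) :
    ∫⁻ q, prodFn (fun r : Plane × M => G r.1 r.2) (fun n => (x q.1 n, q.2 n))
        ∂(P.prod (Measure.infinitePi fun _ : ℕ => μ)) =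
      EReal.exp (-(∫⁻ e : Plane, ∫⁻ z, (1 - G e z) ∂μ : ℝ≥0∞)) := by
  have hGe : ∀ e, Measurable (G e) := fun e => hG.comp measurable_prodMk_left
  have hmeas : Measurable fun q : Ω₀ × (ℕ → M) =>
      prodFn (fun r : Plane × M => G r.1 r.2) (fun n => (x q.1 n, q.2 n)) :=
    (measurable_prodFn hG).comp (by fun_prop)
  rw [lintegral_prod _ hmeas.aemeasurable]
  simp_rw [lintegral_prodFn_infinitePi μ hGe hG1]
  have hle : ∀ e, ∫⁻ z, G e z ∂μ ≤ 1 := fun e =>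
    (lintegral_mono (hG1 e)).trans (by simp)
  rw [hP.lintegral_prodFn hx hinj hG.lintegral_prod_right hle]
  congr 3
  refine lintegral_congr fun e => ?_
  rw [lintegral_sub (hGe e) ((hle e).trans_lt ENNReal.one_lt_top).ne (.of_forall (hG1 e))]
  simp

/-- Fubini and translation invariance of Lebesgue measure for each fixed `z`; this is the source of
reversibility, whatever the law of the displacement. -/
theorem lintegral_lintegral_shift (μ : Measure M) [SFinite μ] {s : M → Plane} (hs : Measurable s)
    {F : Plane → Plane → ℝ≥0∞} (hF : Measurable (Function.uncurry F)) :
    ∫⁻ e : Plane, ∫⁻ z, F e (e + s z) ∂μ = ∫⁻ e : Plane, ∫⁻ z, F (e - s z) e ∂μ := by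
  have h1 : Measurable (Function.uncurry fun (e : Plane) (z : M) => F e (e + s z)) :=
    hF.comp (f := fun q : Plane × M => (q.1, q.1 + s q.2)) (by fun_prop)
  have h2 : Measurable (Function.uncurry fun (e : Plane) (z : M) => F (e - s z) e) :=
    hF.comp (f := fun q : Plane × M => (q.1 - s q.2, q.1)) (by fun_prop)
  rw [lintegral_lintegral_swap h1.aemeasurable, lintegral_lintegral_swap h2.aemeasurable]
  refine lintegral_congr fun z => ?_
  rw [← lintegral_add_right_eq_self (fun e => F (e - s z) e) (s z)]
  simp

/-- The sequence of the pairs (initial position, displaced position) and the sequence of the pairs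
(position displaced backwards, initial position) have the same law up to relabelling. -/
theorem IsPoissonProcess.lintegral_displaced [IsProbabilityMeasure P] (hx : Measurable x)
    (hinj : ∀ᵐ ω ∂P, Function.Injective (x ω))
    (hP : IsPoissonProcess P fun ω => Set.range (x ω)) {s : M → Plane} (hs : Measurable s)
    {Φ : (ℕ → Plane × Plane) → ℝ≥0∞} (hΦ : Measurable Φ)
    (hΦ_perm : ∀ (π : Equiv.Perm ℕ) (y : ℕ → Plane × Plane), Φ (y ∘ π) = Φ y) :
    ∫⁻ q, Φ (fun n => (x q.1 n, x q.1 n + s (q.2 n)))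
        ∂(P.prod (Measure.infinitePi fun _ : ℕ => μ)) =
      ∫⁻ q, Φ (fun n => (x q.1 n - s (q.2 n), x q.1 n))
        ∂(P.prod (Measure.infinitePi fun _ : ℕ => μ)) := by
  set ρ := P.prod (Measure.infinitePi fun _ : ℕ => μ)
  let f₁ : Ω₀ × (ℕ → M) → ℕ → Plane × Plane := fun q n => (x q.1 n, x q.1 n + s (q.2 n))
  let f₂ : Ω₀ × (ℕ → M) → ℕ → Plane × Plane := fun q n => (x q.1 n - s (q.2 n), x q.1 n)
  have hf₁ : Measurable f₁ := by fun_prop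
  have hf₂ : Measurable f₂ := by fun_prop
  let σ : Plane × Plane → ℝ := fun e =>
    unitInterval.sigmoid (embeddingReal (Plane × Plane) e)
  have hσ_inj : Function.Injective σ := fun e e' h =>
    (measurableEmbedding_sigmoid_comp_embeddingReal (Plane × Plane)).injective (Subtype.ext h)
  have hσ_meas : Measurable σ := measurable_subtype_coe.comp
    (measurableEmbedding_sigmoid_comp_embeddingReal (Plane × Plane)).measurable
  have hσ0 : ∀ e, 0 ≤ σ e := fun e => (unitInterval.sigmoid (embeddingReal _ e)).2.1
  have hσ1 : ∀ e, σ e ≤ 1 := fun e => (unitInterval.sigmoid (embeddingReal _ e)).2.2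
  -- A sublevel set of `ψ` bounds the first coordinate, so it contains finitely many terms when the
  -- first coordinates are locally finite. The factor 2 keeps blocks with different integer parts
  -- disjoint, as `σ` takes values in [0, 1].
  let ψ : Plane × Plane → ℝ := fun e => 2 * (⌊‖e.1‖⌋₊ : ℝ) + σ e
  have hψ : Measurable ψ := by
    have : Measurable fun e : Plane × Plane => (⌊‖e.1‖⌋₊ : ℝ) :=
      measurable_from_top.comp (Nat.measurable_floor.comp measurable_fst.norm)
    exact (this.const_mul 2).add hσ_meas
  have hψ_inj : Function.Injective ψ := by
    intro e e' h
    simp only [ψ] at h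
    have h1 : ⌊‖e.1‖⌋₊ = ⌊‖e'.1‖⌋₊ := by
      have a1 := hσ0 e; have a2 := hσ1 e; have a3 := hσ0 e'; have a4 := hσ1 e'
      by_contra hne
      rcases Nat.lt_or_gt_of_ne hne with hlt | hlt
      · have : (⌊‖e.1‖⌋₊ : ℝ) + 1 ≤ ⌊‖e'.1‖⌋₊ := by exact_mod_cast hlt
        linarith
      · have : (⌊‖e'.1‖⌋₊ : ℝ) + 1 ≤ ⌊‖e.1‖⌋₊ := by exact_mod_cast hlt
        linarith
    rw [h1] at h
    exact hσ_inj (by linarith)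
  have hxae : ∀ᵐ q ∂ρ, Function.Injective (x q.1) ∧ LocFinite (Set.range (x q.1)) :=
    Measure.quasiMeasurePreserving_fst.ae (hinj.and hP.ae_locFinite)
  have : IsProbabilityMeasure (ρ.map f₁) := Measure.isProbabilityMeasure_map hf₁.aemeasurable
  have : IsProbabilityMeasure (ρ.map f₂) := Measure.isProbabilityMeasure_map hf₂.aemeasurable
  have hinj_meas : MeasurableSet {y : ℕ → Plane × Plane | Function.Injective y} := by
    refine measurableSet_setOfPred.2 <| Measurable.forall fun i => Measurable.forall fun j =>
      Measurable.imp (measurableSet_setOfPred.1 ?_) measurable_const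
    exact measurableSet_eq_fun (measurable_pi_apply i) (measurable_pi_apply j)
  -- Finiteness is needed for one of the two laws only. It is checked for the forward pairs, whose
  -- first coordinates are the Poisson points themselves.
  have key := lintegral_eq_of_prodFn_eq hψ hψ_inj (m := ρ.map f₁) (m' := ρ.map f₂) ?_ ?_ ?_ ?_ hΦ
    hΦ_perm
  · rwa [lintegral_map hΦ hf₁, lintegral_map hΦ hf₂] at key
  · intro g hg hg1
    rw [lintegral_map (measurable_prodFn hg) hf₁, lintegral_map (measurable_prodFn hg) hf₂]
    have e1 := hP.lintegral_prodFn_prod (μ := μ) hx hinj (G := fun e z => g (e, e + s z))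
      (hg.comp (f := fun q : Plane × M => (q.1, q.1 + s q.2)) (by fun_prop)) fun e z => hg1 _
    have e2 := hP.lintegral_prodFn_prod (μ := μ) hx hinj (G := fun e z => g (e - s z, e))
      (hg.comp (f := fun q : Plane × M => (q.1 - s q.2, q.1)) (by fun_prop)) fun e z => hg1 _
    refine e1.trans (Eq.trans ?_ e2.symm)
    rw [lintegral_lintegral_shift μ hs (F := fun e e' => 1 - g (e, e'))]
    exact measurable_const.sub hg
  · rw [ae_map_iff hf₁.aemeasurable hinj_meas]
    filter_upwards [hxae] with q hq i j hij
    exact hq.1 (congrArg Prod.fst hij)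
  · rw [ae_map_iff hf₂.aemeasurable hinj_meas]
    filter_upwards [hxae] with q hq i j hij
    exact hq.1 (congrArg Prod.snd hij)
  · have hmeas : MeasurableSet {y : ℕ → Plane × Plane | ∀ r : ℕ, {n | ψ (y n) ≤ r}.Finite} := by
      refine measurableSet_setOfPred.2 <| Measurable.forall fun r => measurableSet_setOfPred.1 ?_
      have hm : Measurable fun y : ℕ → Plane × Plane => {n | ψ (y n) ≤ r}.encard :=
        measurable_encard_setOf fun n =>
          measurableSet_le (hψ.comp (measurable_pi_apply n)) measurable_const
      simp_rw [← Set.encard_ne_top_iff]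
      exact hm (MeasurableSet.of_discrete (s := {⊤}ᶜ))
    have h1 : ∀ᵐ y ∂(ρ.map f₁), ∀ r : ℕ, {n | ψ (y n) ≤ r}.Finite := by
      rw [ae_map_iff hf₁.aemeasurable hmeas]
      filter_upwards [hxae] with q hq r
      refine ((locFinite_range_iff hq.1).1 hq.2 (r + 1)).subset fun n hn => ?_
      have hn' : 2 * (⌊‖x q.1 n‖⌋₊ : ℝ) + σ (f₁ q n) ≤ r := hn
      have a1 := hσ0 (f₁ q n)
      have a2 := (Nat.lt_floor_add_one ‖x q.1 n‖).le
      have a3 : (0 : ℝ) ≤ ⌊‖x q.1 n‖⌋₊ := Nat.cast_nonneg _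
      simp only [Set.mem_ofPred_eq]
      push_cast
      linarith
    filter_upwards [h1] with y hy q
    obtain ⟨r, hr⟩ := exists_nat_ge q
    exact (hy r).subset fun n (hn : ψ (y n) ≤ q) => hn.trans hr

end Poisson

/-! ### Enumeration of finite configurations -/

theorem exists_measurable_leftInverse_embeddingReal :
    ∃ f : ℝ → Plane, Measurable f ∧ ∀ y, f (embeddingReal Plane y) = y := by
  obtain ⟨f, hf, hf'⟩ := (measurableEmbedding_embeddingReal Plane).exists_measurable_extend
    measurable_id fun _ => inferInstance
  exact ⟨f, hf, fun y => congrFun hf' y⟩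

/-- The `m`-th point of a finite configuration, for some measurable ordering of the plane. -/
noncomputable def enumConfig (m : ℕ) (S : Config) : Plane :=
  exists_measurable_leftInverse_embeddingReal.choose
    (orderStat (fun q => halfPow (S.carrier ∩ {y | embeddingReal Plane y ≤ q}).encard) m)

theorem measurable_enumConfig (m : ℕ) : Measurable (enumConfig m) := by
  refine exists_measurable_leftInverse_embeddingReal.choose_spec.1.comp ?_
  refine (measurable_pi_apply m).comp (measurable_orderStat.comp (measurable_pi_lambda _ fun q => ?_))
  exact measurable_halfPow.comp <| measurable_config_encard <|
    measurableSet_le (measurable_embeddingReal Plane) measurable_const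

theorem exists_perm_enumConfig {p : ℕ → Plane} (hp : Function.Injective p) (I : Finset ℕ) :
    ∃ π : Equiv.Perm ℕ, (∀ m, π m ∈ I ↔ m < I.card) ∧
      ∀ m < I.card, enumConfig m (finConfig p I) = p (π m) := by
  obtain ⟨π, h1, h2⟩ := exists_perm_sort_finset
    ((measurableEmbedding_embeddingReal Plane).injective.comp hp) I
  refine ⟨π, h1, fun m hm => ?_⟩
  rw [enumConfig, ← exists_measurable_leftInverse_embeddingReal.choose_spec.2 (p (π m))]
  refine congrArg _ (orderStat_eq fun q => ?_)
  have hcount := succ_le_encard_le_iff ((h1 m).2 hm) (h2 m hm) q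
  simp only [Function.comp_apply] at hcount
  rw [← hcount, halfPow_le_iff]
  have : (finConfig p I).carrier ∩ {y | embeddingReal Plane y ≤ q} =
      p '' {k | k ∈ (I : Set ℕ) ∧ embeddingReal Plane (p k) ≤ q} :=
    (Set.image_inter_preimage p I _).symm
  rw [this, hp.encard_image]

section Displacement

variable {M : Type*} [MeasurableSpace M]

/-- The probability that the points of the finite configuration `S` are in `A` after independent
displacements by `s z`, where `z` has law `μ`. -/
noncomputable def displacedProb (μ : Measure M) [IsProbabilityMeasure μ] (s : M → Plane)
    (A : Set Config) (S : Config) : ℝ≥0∞ :=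
  (Measure.infinitePi fun _ : ℕ => μ)
    {z | finConfig (fun m => enumConfig m S + s (z m)) (Finset.range S.carrier.encard.toNat) ∈ A}

variable {μ : Measure M} [IsProbabilityMeasure μ] {s : M → Plane} {A : Set Config}

theorem measurable_displacedProb (hs : Measurable s) (hA : MeasurableSet A) :
    Measurable (displacedProb μ s A) := by
  have hcard : Measurable fun S : Config => S.carrier.encard.toNat := by
    refine measurable_from_top.comp ?_
    simpa using measurable_config_encard MeasurableSet.univ
  have hset : MeasurableSet {q : Config × (ℕ → M) |
      finConfig (fun m => enumConfig m q.1 + s (q.2 m))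
        (Finset.range q.1.carrier.encard.toNat) ∈ A} := by
    have : {q : Config × (ℕ → M) | finConfig (fun m => enumConfig m q.1 + s (q.2 m))
        (Finset.range q.1.carrier.encard.toNat) ∈ A} =
        ⋃ k : ℕ, {q | q.1.carrier.encard.toNat = k} ∩
          {q | finConfig (fun m => enumConfig m q.1 + s (q.2 m)) (Finset.range k) ∈ A} := by
      ext q
      simp
    rw [this]
    refine MeasurableSet.iUnion fun k => MeasurableSet.inter ?_ ?_
    · exact (hcard.comp measurable_fst) (measurableSet_singleton k)
    · refine ((measurable_finConfig (Finset.range k)).comp ?_) hA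
      refine measurable_pi_lambda _ fun m => ((measurable_enumConfig m).comp measurable_fst).add ?_
      exact hs.comp ((measurable_pi_apply m).comp measurable_snd)
  exact measurable_measure_prodMk_left hset

/-- Enumerating the set by `enumConfig` instead of by labels permutes the displacements, and their
i.i.d. law is invariant under permutations. -/
theorem displacedProb_finConfig (hs : Measurable s) (hA : MeasurableSet A) {p : ℕ → Plane}
    (hp : Function.Injective p) (I : Finset ℕ) :
    displacedProb μ s A (finConfig p I) =
      (Measure.infinitePi fun _ : ℕ => μ) {z | finConfig (fun n => p n + s (z n)) I ∈ A} := by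
  obtain ⟨π, h1, h2⟩ := exists_perm_enumConfig hp I
  have hcard : (finConfig p I).carrier.encard.toNat = I.card := by
    have : (finConfig p I).carrier = p '' I := rfl
    rw [this, hp.encard_image, Set.encard_coe_eq_coe_finsetCard, ENat.toNat_natCast]
  have hmap := Measure.map_infinitePi_infinitePi_of_inj (P := fun _ : ℕ => μ) π.symm.injective
  have hmeas : MeasurableSet {z : ℕ → M | finConfig (fun n => p n + s (z n)) I ∈ A} :=
    ((measurable_finConfig I).comp (measurable_pi_lambda _ fun m =>
      (hs.comp (measurable_pi_apply m)).const_add _)) hA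
  rw [displacedProb, hcard]
  conv_rhs => rw [← hmap]
  rw [Measure.map_apply (by fun_prop) hmeas]
  congr 1
  ext z
  simp only [Set.mem_ofPred_eq, Set.mem_preimage]
  suffices h : finConfig (fun m => enumConfig m (finConfig p I) + s (z m)) (Finset.range I.card) =
      finConfig (fun n => p n + s (z (π.symm n))) I by rw [h]
  refine Config.ext' ?_
  ext y
  simp only [finConfig, Set.mem_image, Finset.coe_range, Set.mem_Iio, Finset.mem_coe]
  constructor
  · rintro ⟨m, hm, rfl⟩
    refine ⟨π m, (h1 m).2 hm, ?_⟩
    have := h2 m hm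
    simp only [finConfig] at this
    rw [this, Equiv.symm_apply_apply]
  · rintro ⟨n, hn, rfl⟩
    have hm : π.symm n < I.card := (h1 _).1 (by simpa using hn)
    refine ⟨π.symm n, hm, ?_⟩
    have := h2 _ hm
    simp only [finConfig] at this
    rw [this, Equiv.apply_symm_apply]

theorem measurable_indicator_finConfig {α : Type*} [MeasurableSpace α] (hA : MeasurableSet A)
    {p : α → ℕ → Plane} (hp : Measurable p) (I : Finset ℕ) :
    Measurable fun a => A.indicator (1 : Config → ℝ≥0∞) (finConfig (p a) I) :=
  (measurable_one.indicator hA).comp ((measurable_finConfig I).comp hp)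

/-! ### Conditional laws of displaced subsets -/

variable {Ω₀ : Type*} [MeasurableSpace Ω₀] {P : Measure Ω₀} {x : Ω₀ → ℕ → Plane}

theorem tsum_finConfig_subset {p : ℕ → Plane} (hp : Function.Injective p) {K : Set Plane}
    (hK : (Set.range p ∩ K).Finite) :
    ∑' I : Finset ℕ, {S : Config | S.carrier ⊆ K}.indicator (1 : Config → ℝ≥0∞) (finConfig p I) =
      2 ^ (Set.range p ∩ K).ncard := by
  classical
  have hJ : {n | p n ∈ K}.Finite := (hK.preimage hp.injOn).subset fun n hn => ⟨⟨n, rfl⟩, hn⟩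
  have hiff : ∀ I : Finset ℕ, finConfig p I ∈ {S : Config | S.carrier ⊆ K} ↔
      I ∈ hJ.toFinset.powerset := by
    intro I
    simp only [finConfig, Set.mem_ofPred_eq, Set.image_subset_iff, Finset.mem_powerset]
    constructor
    · intro h n hn
      simpa using h hn
    · intro h n hn
      simpa using h hn
  rw [tsum_eq_sum (s := hJ.toFinset.powerset)]
  · rw [Finset.sum_congr rfl fun I hI => Set.indicator_of_mem ((hiff I).2 hI) _]
    simp [ncard_range_inter hp, Set.ncard_eq_toFinset_card _ hJ]
  · intro I hI
    exact Set.indicator_of_notMem (fun h => hI ((hiff I).1 h)) _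

theorem measurableSet_config_subset {K : Set Plane} (hK : MeasurableSet K) :
    MeasurableSet {S : Config | S.carrier ⊆ K} := by
  have : {S : Config | S.carrier ⊆ K} = (fun S : Config => (S.carrier ∩ Kᶜ).encard) ⁻¹' {0} := by
    ext S
    simp [Set.disjoint_compl_right_iff_subset, ← Set.disjoint_iff_inter_eq_empty]
  rw [this]
  exact measurable_config_encard hK.compl (measurableSet_singleton 0)

/-- The expected number of finite sets `I` of labels such that the positions of the corresponding
points before and after displacement are in a given set. -/
noncomputable def displacedPairs (P : Measure Ω₀) (x : Ω₀ → ℕ → Plane) (μ : Measure M)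
    [IsProbabilityMeasure μ] (s : M → Plane) : Measure (Config × Config) :=
  Measure.sum fun I : Finset ℕ => (P.prod (Measure.infinitePi fun _ : ℕ => μ)).map fun q =>
    (finConfig (x q.1) I, finConfig (fun n => x q.1 n + s (q.2 n)) I)

theorem measurable_displacedPairs_fun (hx : Measurable x) (hs : Measurable s) (I : Finset ℕ) :
    Measurable fun q : Ω₀ × (ℕ → M) =>
      (finConfig (x q.1) I, finConfig (fun n => x q.1 n + s (q.2 n)) I) :=
  ((measurable_finConfig I).comp (hx.comp measurable_fst)).prodMk
    ((measurable_finConfig I).comp (by fun_prop))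

theorem lintegral_fst_displacedPairs [SFinite P] (hx : Measurable x) (hs : Measurable s)
    {f : Config → ℝ≥0∞} (hf : Measurable f) :
    ∫⁻ S, f S ∂(displacedPairs P x μ s).fst = ∑' I, ∫⁻ ω, f (finConfig (x ω) I) ∂P := by
  rw [Measure.fst, lintegral_map hf measurable_fst, displacedPairs, lintegral_sum_measure]
  refine tsum_congr fun I => ?_
  rw [lintegral_map (f := fun S : Config × Config => f S.1) (hf.comp measurable_fst)
    (measurable_displacedPairs_fun hx hs I)]
  have hm : Measurable fun q : Ω₀ × (ℕ → M) => f (finConfig (x q.1) I) :=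
    hf.comp ((measurable_finConfig I).comp (hx.comp measurable_fst))
  rw [lintegral_prod _ hm.aemeasurable]
  simp

/-- Fubini for each label set: `displacedProb` is an explicit version of the conditional law, to be
compared with an arbitrary kernel. -/
theorem displacedPairs_prod [SFinite P] (hx : Measurable x)
    (hinj : ∀ᵐ ω ∂P, Function.Injective (x ω)) (hs : Measurable s)
    (hA : MeasurableSet A) {C : Set Config} (hC : MeasurableSet C) :
    displacedPairs P x μ s (C ×ˢ A) =
      ∫⁻ S in C, displacedProb μ s A S ∂(displacedPairs P x μ s).fst := by
  rw [← lintegral_indicator hC, lintegral_fst_displacedPairs hx hs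
    ((measurable_displacedProb hs hA).indicator hC), displacedPairs,
    Measure.sum_apply _ (hC.prod hA)]
  refine tsum_congr fun I => ?_
  have hm := measurable_displacedPairs_fun hx hs I
  rw [Measure.map_apply hm (hC.prod hA), Measure.prod_apply (hm (hC.prod hA))]
  refine lintegral_congr_ae ?_
  filter_upwards [hinj] with ω hω
  by_cases hC' : finConfig (x ω) I ∈ C
  · rw [Set.indicator_of_mem hC', displacedProb_finConfig hs hA hω]
    congr 1
    ext z
    simp [hC']
  · rw [Set.indicator_of_notMem hC']
    have : Prod.mk ω ⁻¹' ((fun q : Ω₀ × (ℕ → M) =>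
        (finConfig (x q.1) I, finConfig (fun n => x q.1 n + s (q.2 n)) I)) ⁻¹' C ×ˢ A) = ∅ := by
      ext z
      simp [hC']
    rw [this, measure_empty]

/-- Two disintegrations of the same measure have equal integrals over every measurable set of
initial configurations. The bound assumed for `κ` on `A` thus passes to `displacedProb`, almost
everywhere, and then to each label set since the marginal is a sum over label sets. -/
theorem ae_displacedProb_le [IsProbabilityMeasure P] (hx : Measurable x)
    (hinj : ∀ᵐ ω ∂P, Function.Injective (x ω))
    (hP : IsPoissonProcess P fun ω => Set.range (x ω)) (hs : Measurable s)
    {κ : Kernel Config Config} [IsMarkovKernel κ] (hκ : (displacedPairs P x μ s).IsCondKernel κ)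
    (hA : MeasurableSet A) {δ : ℝ≥0∞} (hδ : ∀ S ∈ A, κ S A ≤ δ) (I : Finset ℕ) :
    ∀ᵐ ω ∂P, finConfig (x ω) I ∈ A → displacedProb μ s A (finConfig (x ω) I) ≤ δ := by
  set ρ := displacedPairs P x μ s with hρ
  have : SFinite ρ := by rw [hρ, displacedPairs]; infer_instance
  have hGm := measurable_displacedProb (μ := μ) hs hA
  -- These sets have finite mass: N points have 2 ^ N subsets, and a Poisson variable has a finite
  -- generating function at 2. Finite mass is what the comparison of integrals requires.
  let E : ℕ → Set Config := fun n => {S | S.carrier ⊆ Metric.closedBall 0 n}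
  have hE : ∀ n, MeasurableSet (E n) := fun n => measurableSet_config_subset measurableSet_closedBall
  have hEfin : ∀ n, ρ.fst (E n) < ∞ := by
    intro n
    rw [← lintegral_indicator_one (hE n), hρ,
      lintegral_fst_displacedPairs hx hs (measurable_one.indicator (hE n)),
      ← lintegral_tsum fun I => (measurable_indicator_finConfig (hE n) hx I).aemeasurable]
    have hvol : volume (Metric.closedBall (0 : Plane) n) ≠ ∞ :=
      (isCompact_closedBall _ _).measure_lt_top.ne
    have h2 := hP.lintegral_pow measurableSet_closedBall hvol (a := 2) (by simp)
    refine lt_of_eq_of_lt (Eq.trans (lintegral_congr_ae ?_) h2) ENNReal.ofReal_lt_top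
    filter_upwards [hinj, hP.ae_finite measurableSet_closedBall hvol] with ω h1 h2
    exact tsum_finConfig_subset h1 h2
  have hae : ∀ n, ∀ᵐ S ∂ρ.fst, S ∈ E n → S ∈ A → displacedProb μ s A S ≤ δ := by
    intro n
    have hEA := (hE n).inter hA
    have : IsFiniteMeasure (ρ.fst.restrict (E n ∩ A)) :=
      ⟨by
        rw [Measure.restrict_apply_univ]
        exact (measure_mono Set.inter_subset_left).trans_lt (hEfin n)⟩
    have h1 : displacedProb μ s A ≤ᵐ[ρ.fst.restrict (E n ∩ A)] fun _ => δ := by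
      refine ae_le_of_forall_setLIntegral_le_of_sigmaFinite hGm fun C hC _ => ?_
      rw [Measure.restrict_restrict hC]
      have hCm : MeasurableSet (C ∩ (E n ∩ A)) := hC.inter hEA
      have hdis : ρ ((C ∩ (E n ∩ A)) ×ˢ A) = ∫⁻ S in C ∩ (E n ∩ A), κ S A ∂ρ.fst := by
        conv_lhs => rw [← hκ.disintegrate]
        exact Measure.compProd_apply_prod hCm hA
      rw [hρ, ← displacedPairs_prod hx hinj hs hA hCm, ← hρ, hdis]
      refine setLIntegral_mono measurable_const fun S (hS : S ∈ C ∩ (E n ∩ A)) => hδ S hS.2.2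
    filter_upwards [(ae_restrict_iff' hEA).1 h1] with S hS h1 h2 using hS ⟨h1, h2⟩
  have hbad : MeasurableSet {S : Config | ∀ n, S ∈ E n → S ∈ A → displacedProb μ s A S ≤ δ} := by
    refine measurableSet_setOfPred.2 <| Measurable.forall fun n => ?_
    refine (measurable_mem.2 (hE n)).imp ((measurable_mem.2 hA).imp (measurableSet_setOfPred.1 ?_))
    exact measurableSet_le hGm measurable_const
  have hall : ρ.fst {S : Config | ∀ n, S ∈ E n → S ∈ A → displacedProb μ s A S ≤ δ}ᶜ = 0 :=
    ae_iff.1 (ae_all_iff.2 hae)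
  rw [← lintegral_indicator_one hbad.compl, hρ,
    lintegral_fst_displacedPairs hx hs (measurable_one.indicator hbad.compl)] at hall
  have hI := ENNReal.tsum_eq_zero.1 hall I
  rw [lintegral_eq_zero_iff (measurable_indicator_finConfig hbad.compl hx I)] at hI
  filter_upwards [hI] with ω hω hωA
  have hgood : finConfig (x ω) I ∈
      {S : Config | ∀ n, S ∈ E n → S ∈ A → displacedProb μ s A S ≤ δ} := by
    by_contra hn
    rw [Set.indicator_of_mem (Set.mem_compl hn)] at hω
    simp at hω
  obtain ⟨R, hR⟩ := (I.finite_toSet.image (x ω)).isBounded.subset_closedBall 0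
  obtain ⟨r, hr⟩ := exists_nat_ge R
  exact hgood r (hR.trans (Metric.closedBall_subset_closedBall hr)) hωA

/-- The weight may depend on all of the initial data, because the displacements are independent of
it: after fixing the initial data, the inner integral is exactly `displacedProb`. -/
theorem lintegral_displaced_le [IsProbabilityMeasure P] (hx : Measurable x)
    (hinj : ∀ᵐ ω ∂P, Function.Injective (x ω))
    (hP : IsPoissonProcess P fun ω => Set.range (x ω)) (hs : Measurable s)
    {κ : Kernel Config Config} [IsMarkovKernel κ] (hκ : (displacedPairs P x μ s).IsCondKernel κ)
    (hA : MeasurableSet A) {δ : ℝ≥0∞} (hδ : ∀ S ∈ A, κ S A ≤ δ) {w : Finset ℕ → Ω₀ → ℝ≥0∞}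
    (hw : ∀ I, Measurable (w I)) :
    ∫⁻ q, ∑' I, w I q.1 * A.indicator 1 (finConfig (x q.1) I) *
        A.indicator 1 (finConfig (fun n => x q.1 n + s (q.2 n)) I)
        ∂(P.prod (Measure.infinitePi fun _ : ℕ => μ)) ≤
      δ * ∫⁻ ω, ∑' I, w I ω * A.indicator 1 (finConfig (x ω) I) ∂P := by
  have hm1 : ∀ I, Measurable fun ω => w I ω * A.indicator 1 (finConfig (x ω) I) := fun I =>
    (hw I).mul (measurable_indicator_finConfig hA hx I)
  have hm2 : ∀ I, Measurable fun q : Ω₀ × (ℕ → M) =>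
      A.indicator (1 : Config → ℝ≥0∞) (finConfig (fun n => x q.1 n + s (q.2 n)) I) := fun I =>
    measurable_indicator_finConfig hA (by fun_prop) I
  have hm12 : ∀ I, Measurable fun q : Ω₀ × (ℕ → M) => w I q.1 *
      A.indicator 1 (finConfig (x q.1) I) *
        A.indicator (1 : Config → ℝ≥0∞) (finConfig (fun n => x q.1 n + s (q.2 n)) I) := fun I =>
    ((hm1 I).comp measurable_fst).mul (hm2 I)
  rw [lintegral_tsum fun I => (hm12 I).aemeasurable,
    lintegral_tsum fun I => (hm1 I).aemeasurable, ← ENNReal.tsum_mul_left]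
  refine ENNReal.tsum_le_tsum fun I => ?_
  rw [lintegral_prod _ (hm12 I).aemeasurable, ← lintegral_const_mul _ (hm1 I)]
  refine lintegral_mono_ae ?_
  filter_upwards [hinj, ae_displacedProb_le hx hinj hP hs hκ hA hδ I] with ω hω hωδ
  have hm3 : Measurable fun z : ℕ → M =>
      A.indicator (1 : Config → ℝ≥0∞) (finConfig (fun n => x ω n + s (z n)) I) :=
    (hm2 I).comp measurable_prodMk_left
  rw [lintegral_const_mul _ hm3, mul_comm δ]
  by_cases hmem : finConfig (x ω) I ∈ A
  · refine mul_le_mul_right (le_trans (le_of_eq ?_) (hωδ hmem)) _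
    rw [displacedProb_finConfig hs hA hω, ← lintegral_indicator_one]
    · rfl
    · exact ((measurable_finConfig I).comp (by fun_prop : Measurable
        fun z : ℕ → M => fun n => x ω n + s (z n))) hA
  · simp [hmem]

end Displacement

/-! ### Fourier coefficients in terms of labels -/

instance isProbabilityMeasure_coin : IsProbabilityMeasure coin :=
  ⟨by simp [coin, ENNReal.inv_two_add_inv_two]⟩

theorem coin_singleton (e : ℤˣ) : coin {e} = 2⁻¹ := by
  rcases Int.units_eq_one_or e with rfl | rfl <;> simp [coin]

/-- The uniform law on the colourings of the labels. -/
noncomputable abbrev coinSeq : Measure (ℕ → ℤˣ) := Measure.infinitePi fun _ => coin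

/-- The Fourier function of a finite set of labels. -/
noncomputable def walsh (I : Finset ℕ) (c : ℕ → ℤˣ) : ℝ := ∏ i ∈ I, (((c i : ℤˣ) : ℤ) : ℝ)

theorem measurable_walsh (I : Finset ℕ) : Measurable (walsh I) :=
  Finset.measurable_fun_prod _ fun i _ =>
    (measurable_of_countable fun e : ℤˣ => ((e : ℤ) : ℝ)).comp (measurable_pi_apply i)

theorem abs_walsh (I : Finset ℕ) (c : ℕ → ℤˣ) : |walsh I c| = 1 := by
  rw [walsh, Finset.abs_prod]
  refine Finset.prod_eq_one fun i _ => ?_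
  rcases Int.units_eq_one_or (c i) with h | h <;> simp [h]

/-- The Fourier coefficient of a function of the colours of the labels. -/
noncomputable def walshCoeff (f : (ℕ → ℤˣ) → ℝ) (I : Finset ℕ) : ℝ := ∫ c, f c * walsh I c ∂coinSeq

theorem integrable_of_bounded {α : Type*} [MeasurableSpace α] {m : Measure α} [IsFiniteMeasure m]
    {f : α → ℝ} (hf : Measurable f) {C : ℝ} (hC : ∀ c, |f c| ≤ C) : Integrable f m :=
  Integrable.of_bound hf.aestronglyMeasurable C (.of_forall hC)

theorem integrable_mul_walsh {f : (ℕ → ℤˣ) → ℝ} (hf : Measurable f) {C : ℝ} (hC : ∀ c, |f c| ≤ C)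
    (I : Finset ℕ) : Integrable (fun c => f c * walsh I c) coinSeq :=
  integrable_of_bounded (hf.mul (measurable_walsh I)) fun c => by
    rw [abs_mul, abs_walsh, mul_one]; exact hC c

/-- The sum factors as the product of 1 + c'(j) c(j) over `J`, and each factor is 2 or 0 according
to whether the colours agree. -/
theorem sum_walsh_mul_walsh (J : Finset ℕ) (c c' : ℕ → ℤˣ) :
    ∑ I ∈ J.powerset, walsh I c' * walsh I c =
      (Set.pi (J : Set ℕ) fun j => {c j}).indicator (fun _ => (2 : ℝ) ^ J.card) c' := by
  simp_rw [walsh, ← Finset.prod_mul_distrib]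
  rw [← Finset.prod_one_add]
  by_cases hc : c' ∈ Set.pi (J : Set ℕ) fun j => {c j}
  · rw [Set.indicator_of_mem hc, ← Finset.prod_const]
    refine Finset.prod_congr rfl fun j hj => ?_
    have : c' j = c j := hc j hj
    rw [this]
    rcases Int.units_eq_one_or (c j) with h | h <;> simp [h] <;> norm_num
  · rw [Set.indicator_of_notMem hc]
    simp only [Set.mem_pi, Finset.mem_coe, Set.mem_singleton_iff, not_forall] at hc
    obtain ⟨j, hj, hne⟩ := hc
    refine Finset.prod_eq_zero hj ?_
    rcases Int.units_eq_one_or (c j) with h | h <;>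
      rcases Int.units_eq_one_or (c' j) with h' | h' <;> simp_all

theorem walsh_expansion {f : (ℕ → ℤˣ) → ℝ} (hf : Measurable f) {C : ℝ} (hC : ∀ c, |f c| ≤ C)
    {J : Finset ℕ} (hJ : DependsOn f (J : Set ℕ)) (c : ℕ → ℤˣ) :
    f c = ∑ I ∈ J.powerset, walshCoeff f I * walsh I c := by
  have hmeas : MeasurableSet (Set.pi (J : Set ℕ) fun j => ({c j} : Set ℤˣ)) :=
    MeasurableSet.pi J.countable_toSet fun j _ => measurableSet_singleton _
  symm
  calc ∑ I ∈ J.powerset, walshCoeff f I * walsh I c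
      = ∫ c', ∑ I ∈ J.powerset, f c' * walsh I c' * walsh I c ∂coinSeq := by
        rw [integral_finsetSum _ fun I _ => (integrable_mul_walsh hf hC I).mul_const _]
        refine Finset.sum_congr rfl fun I _ => ?_
        rw [integral_mul_const]
        rfl
    _ = ∫ c', (Set.pi (J : Set ℕ) fun j => {c j}).indicator (fun _ => f c * 2 ^ J.card) c'
          ∂coinSeq := by
        refine integral_congr_ae (.of_forall fun c' => ?_)
        dsimp only
        simp_rw [mul_assoc]
        rw [← Finset.mul_sum, sum_walsh_mul_walsh]
        by_cases hc : c' ∈ Set.pi (J : Set ℕ) fun j => ({c j} : Set ℤˣ)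
        · rw [Set.indicator_of_mem hc, Set.indicator_of_mem hc, hJ fun j hj => hc j hj]
        · rw [Set.indicator_of_notMem hc, Set.indicator_of_notMem hc, mul_zero]
    -- The cylinder of colourings that agree with `c` on `J` has probability 2 ^ (-|J|), which
    -- cancels the height of the kernel.
    _ = f c := by
        rw [integral_indicator_const _ hmeas, measureReal_def, Measure.infinitePi_pi]
        · simp_rw [coin_singleton]
          simp only [Finset.prod_const, ENNReal.toReal_pow, ENNReal.toReal_inv, smul_eq_mul,
            ENNReal.toReal_ofNat]
          rw [mul_comm, mul_assoc, ← mul_pow]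
          norm_num
        · exact fun j _ => measurableSet_singleton _

/-- Expanding `f` alone suffices, so `g` need not depend on finitely many coordinates. In the
application finite dependence is used at time 0 only. -/
theorem integral_mul_eq_sum_walshCoeff {f g : (ℕ → ℤˣ) → ℝ} (hf : Measurable f) (hg : Measurable g)
    {C : ℝ} (hC : ∀ c, |f c| ≤ C) (hC' : ∀ c, |g c| ≤ C) {J : Finset ℕ}
    (hJ : DependsOn f (J : Set ℕ)) :
    ∫ c, f c * g c ∂coinSeq = ∑ I ∈ J.powerset, walshCoeff f I * walshCoeff g I := by
  have : (fun c => f c * g c) =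
      fun c => ∑ I ∈ J.powerset, walshCoeff f I * (g c * walsh I c) := by
    funext c
    conv_lhs => rw [walsh_expansion hf hC hJ c]
    rw [Finset.sum_mul]
    exact Finset.sum_congr rfl fun I _ => by ring
  rw [this, integral_finsetSum _ fun I _ => (integrable_mul_walsh hg hC' I).const_mul _]
  refine Finset.sum_congr rfl fun I _ => ?_
  rw [integral_const_mul]
  rfl

/-! ### From coloured configurations to labelled sequences -/

theorem ColConfig.ext_of_ofColor {w w' : ColConfig} (hpts : w.pts.carrier = w'.pts.carrier)
    (hcol : ∀ e, w.ofColor e = w'.ofColor e) : w = w' := by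
  obtain ⟨η, c⟩ := w
  obtain ⟨η', c'⟩ := w'
  obtain rfl : η = η' := Config.ext' hpts
  congr 1
  funext y
  have h1 : (y : Plane) ∈ ColConfig.ofColor ⟨η, c⟩ (c y) := ⟨y.2, rfl⟩
  rw [hcol] at h1
  obtain ⟨_, h2⟩ := h1
  exact h2.symm

theorem comp_perm_mem_goodSeq {p : ℕ → Plane} (π : Equiv.Perm ℕ) :
    p ∘ π ∈ goodSeq ↔ p ∈ goodSeq := by
  simp only [goodSeq, Set.mem_ofPred_eq, EquivLike.range_comp, EquivLike.injective_comp]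

theorem finConfig_comp_perm (p : ℕ → Plane) (π : Equiv.Perm ℕ) (I : Finset ℕ) :
    finConfig (p ∘ π) I = finConfig p (I.map π.toEmbedding) := by
  refine Config.ext' ?_
  simp [finConfig, Set.image_image]

/-- The identity includes the default value for bad sequences, so relabelling invariance of the
coefficients holds everywhere, with no almost sure statement about time `t`. -/
theorem mkColored_comp_perm (p : ℕ → Plane) (π : Equiv.Perm ℕ) (c : ℕ → ℤˣ) :
    mkColored (p ∘ π) c = mkColored p (c ∘ π.symm) := by
  by_cases hp : p ∈ goodSeq
  · have hp' := (comp_perm_mem_goodSeq π).2 hp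
    refine ColConfig.ext_of_ofColor ?_ fun e => ?_
    · rw [mkColored_pts hp, mkColored_pts hp']
      exact EquivLike.range_comp p π
    · rw [mkColored_ofColor hp, mkColored_ofColor hp', Set.image_comp]
      congr 1
      ext n
      simp only [Set.mem_image, Set.mem_ofPred_eq, Function.comp_apply]
      constructor
      · rintro ⟨m, hm, rfl⟩
        simpa using hm
      · intro hn
        exact ⟨π.symm n, hn, by simp⟩
  · rw [mkColored_of_not_mem hp, mkColored_of_not_mem fun h => hp ((comp_perm_mem_goodSeq π).1 h)]

/-- The Fourier coefficient of `h` at the set of the points with label in `I`, for the configuration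
with points `p n`. -/
noncomputable def labelCoeff (h : ColConfig → ℝ) (p : ℕ → Plane) (I : Finset ℕ) : ℝ :=
  walshCoeff (fun c => h (mkColored p c)) I

variable {h : ColConfig → ℝ}

theorem measurable_comp_mkColored (h_meas : Measurable h) (p : ℕ → Plane) :
    Measurable fun c => h (mkColored p c) :=
  h_meas.comp (measurable_mkColored.comp measurable_prodMk_left)

theorem measurable_labelCoeff (h_meas : Measurable h) (I : Finset ℕ) :
    Measurable fun p => labelCoeff h p I := by
  have : Measurable fun q : (ℕ → Plane) × (ℕ → ℤˣ) => h (mkColored q.1 q.2) * walsh I q.2 :=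
    (h_meas.comp measurable_mkColored).mul ((measurable_walsh I).comp measurable_snd)
  exact this.stronglyMeasurable.integral_prod_right.measurable

theorem abs_labelCoeff_le {C : ℝ} (hC : ∀ w, |h w| ≤ C) (p : ℕ → Plane) (I : Finset ℕ) :
    |labelCoeff h p I| ≤ C := by
  have := norm_integral_le_of_norm_le_const (μ := coinSeq)
    (f := fun c => h (mkColored p c) * walsh I c) (C := C) (.of_forall fun c => by
      rw [Real.norm_eq_abs, abs_mul, abs_walsh, mul_one]; exact hC _)
  simpa [labelCoeff, walshCoeff] using this

theorem labelCoeff_comp_perm (h_meas : Measurable h) (p : ℕ → Plane) (π : Equiv.Perm ℕ)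
    (I : Finset ℕ) : labelCoeff h (p ∘ π) I = labelCoeff h p (I.map π.toEmbedding) := by
  have hmap := Measure.map_infinitePi_infinitePi_of_inj (P := fun _ : ℕ => coin) π.symm.injective
  have hm : Measurable fun c => h (mkColored p c) * walsh (I.map π.toEmbedding) c :=
    (measurable_comp_mkColored h_meas p).mul (measurable_walsh _)
  rw [labelCoeff, labelCoeff, walshCoeff, walshCoeff]
  conv_rhs => rw [coinSeq, ← hmap]
  rw [integral_map (measurable_pi_lambda _ fun _ => measurable_pi_apply _).aemeasurable
    hm.aestronglyMeasurable]
  refine integral_congr_ae (.of_forall fun c => ?_)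
  simp only [mkColored_comp_perm, walsh, Finset.prod_map]
  simp [Function.comp_def]

theorem restrictTo_range {p : ℕ → Plane} (hp : p ∈ goodSeq) (h : ColConfig → ℝ) (c : Set.range p → ℤˣ) :
    restrictTo h ⟨Set.range p, hp.2⟩ c = h (mkColored p (c ∘ Equiv.ofInjective p hp.1)) := by
  rw [restrictTo]
  congr 1
  refine ColConfig.ext_of_ofColor ?_ fun e => ?_
  · rw [mkColored_pts hp]
  · rw [mkColored_ofColor hp]
    ext y
    simp only [ColConfig.ofColor, Set.mem_ofPred_eq, Set.mem_image, Function.comp_apply]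
    constructor
    · rintro ⟨⟨n, rfl⟩, hn⟩
      exact ⟨n, hn, rfl⟩
    · rintro ⟨n, hn, rfl⟩
      exact ⟨⟨n, rfl⟩, hn⟩

/-- The bijection from labels to points carries one uniform product measure to the other; through it
the intrinsic coefficients become functions of labels. -/
theorem fourierCoeff_range {p : ℕ → Plane} (hp : p ∈ goodSeq) (h_meas : Measurable h) (I : Finset ℕ) :
    fourierCoeff h ⟨Set.range p, hp.2⟩ (I.map (Equiv.ofInjective p hp.1).toEmbedding) =
      labelCoeff h p I := by
  have hmap := Measure.map_infinitePi_infinitePi_of_inj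
    (P := fun _ : Set.range p => coin) (Equiv.ofInjective p hp.1).injective
  have hm : Measurable fun c => h (mkColored p c) * walsh I c :=
    (measurable_comp_mkColored h_meas p).mul (measurable_walsh _)
  rw [labelCoeff, walshCoeff, coinSeq, ← hmap,
    integral_map (measurable_pi_lambda _ fun _ => measurable_pi_apply _).aemeasurable
      hm.aestronglyMeasurable, fourierCoeff]
  refine integral_congr_ae (.of_forall fun c => ?_)
  simp only [restrictTo_range hp, chi, walsh, Finset.prod_map]
  rfl

theorem quenchedExp_range {p : ℕ → Plane} (hp : p ∈ goodSeq) (h_meas : Measurable h) :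
    quenchedExp h ⟨Set.range p, hp.2⟩ = labelCoeff h p ∅ := by
  rw [← fourierCoeff_range hp h_meas, fourierCoeff, quenchedExp]
  simp [chi]

theorem quenchedSpectral_range {p : ℕ → Plane} (hp : p ∈ goodSeq) (h_meas : Measurable h) (A : Set Config) :
    quenchedSpectral h ⟨Set.range p, hp.2⟩ A =
      ∑' I, ENNReal.ofReal (labelCoeff h p I ^ 2) * A.indicator 1 (finConfig p I) := by
  rw [quenchedSpectral, ← (Equiv.finsetCongr (Equiv.ofInjective p hp.1)).tsum_eq]
  refine tsum_congr fun I => ?_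
  rw [Equiv.finsetCongr_apply, fourierCoeff_range hp h_meas]
  have : finConfig (fun y : Set.range p => (y : Plane))
      (I.map (Equiv.ofInjective p hp.1).toEmbedding) = finConfig p I := by
    refine Config.ext' ?_
    simp only [finConfig, Finset.coe_map, Set.image_image]
    rfl
  rw [this]
  split_ifs with hI <;> simp [hI]

theorem exists_dependsOn_labels {p : ℕ → Plane} (hp : p ∈ goodSeq) {F : Finset (Set.range p)}
    (hF : DependsOn (restrictTo h ⟨Set.range p, hp.2⟩) (F : Set (Set.range p))) :
    ∃ J : Finset ℕ, DependsOn (fun c => h (mkColored p c)) (J : Set ℕ) := by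
  refine ⟨F.map (Equiv.ofInjective p hp.1).symm.toEmbedding, fun c c' hc => ?_⟩
  have key : ∀ c : ℕ → ℤˣ, h (mkColored p c) =
      restrictTo h ⟨Set.range p, hp.2⟩ (c ∘ (Equiv.ofInjective p hp.1).symm) := by
    intro c
    rw [restrictTo_range hp]
    congr 2
    funext n
    simp
  dsimp only
  rw [key, key]
  refine hF fun y hy => hc _ ?_
  simpa using hy

/-! ### The joint law of positions, colours and trajectories -/

/-- The two laws are compared on finite boxes, where Fubini leaves a product of functions of
independent coordinates. -/
theorem infinitePi_prod_map_unzip {X Y : Type*} [MeasurableSpace X] [MeasurableSpace Y]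
    (μ : Measure X) (ν : Measure Y) [IsProbabilityMeasure μ] [IsProbabilityMeasure ν] :
    (Measure.infinitePi fun _ : ℕ => μ.prod ν).map
        (fun w => ((fun n => (w n).1), (fun n => (w n).2))) =
      (Measure.infinitePi fun _ : ℕ => μ).prod (Measure.infinitePi fun _ : ℕ => ν) := by
  have hzip : ((Measure.infinitePi fun _ : ℕ => μ).prod (Measure.infinitePi fun _ : ℕ => ν)).map
      (fun q n => (q.1 n, q.2 n)) = Measure.infinitePi fun _ : ℕ => μ.prod ν := by
    refine Measure.eq_infinitePi _ fun s t ht => ?_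
    have hmeas : MeasurableSet (Set.pi (s : Set ℕ) t) :=
      MeasurableSet.pi s.countable_toSet fun i _ => ht i
    have hf : Measurable fun (q : (ℕ → X) × (ℕ → Y)) (n : ℕ) => (q.1 n, q.2 n) := by fun_prop
    rw [Measure.map_apply hf hmeas, Measure.prod_apply (hf hmeas)]
    have h1 : ∀ c : ℕ → X, (Measure.infinitePi fun _ : ℕ => ν)
        (Prod.mk c ⁻¹' ((fun (q : (ℕ → X) × (ℕ → Y)) (n : ℕ) => (q.1 n, q.2 n)) ⁻¹'
          Set.pi (s : Set ℕ) t)) = ∏ i ∈ s, ν (Prod.mk (c i) ⁻¹' t i) := by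
      intro c
      rw [← Measure.infinitePi_pi _ fun i _ => measurable_prodMk_left (ht i)]
      rfl
    simp_rw [h1]
    have hν : ∀ i, Measurable fun a => ν (Prod.mk a ⁻¹' t i) :=
      fun i => measurable_measure_prodMk_left (ht i)
    rw [lintegral_prod_eq_prod_lintegral_of_indepFun s
      (fun i (c : ℕ → X) => ν (Prod.mk (c i) ⁻¹' t i))
      (iIndepFun_infinitePi (X := fun i a => ν (Prod.mk a ⁻¹' t i)) hν)
      fun i => (hν i).comp (measurable_pi_apply i)]
    refine Finset.prod_congr rfl fun i _ => ?_
    rw [Measure.prod_apply (ht i)]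
    conv_rhs => rw [← Measure.infinitePi_map_eval (fun _ : ℕ => μ) i]
    rw [lintegral_map (hν i) (measurable_pi_apply i)]
  rw [← hzip, Measure.map_map (by fun_prop) (by fun_prop)]
  exact Measure.map_id

theorem CadlagPath.measurable_val (t : ℝ≥0) : Measurable fun f : CadlagPath => f.val t :=
  (measurable_pi_apply t).comp (comap_measurable _)

namespace MuDynamics

variable {Ω₀ : Type*} [MeasurableSpace Ω₀] {P : Measure Ω₀} {μ : Measure CadlagPath}

/-- The sequence of the initial positions. -/
def start (D : MuDynamics P μ) (ω : Ω₀) (n : ℕ) : Plane := D.x n ω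

/-- The sequence of the trajectories. -/
def paths (D : MuDynamics P μ) (ω : Ω₀) (n : ℕ) : CadlagPath := D.X n ω

/-- The sequence of the colours. -/
def colors (D : MuDynamics P μ) (ω : Ω₀) (n : ℕ) : ℤˣ := D.ε n ω

variable (D : MuDynamics P μ)

theorem measurable_start : Measurable D.start := measurable_pi_lambda _ D.measurable_x

theorem measurable_paths : Measurable D.paths := measurable_pi_lambda _ D.measurable_X

theorem measurable_colors : Measurable D.colors := measurable_pi_lambda _ D.measurable_ε

theorem measurable_pos (t : ℝ≥0) : Measurable (D.pos t) :=
  measurable_pi_lambda _ fun n =>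
    (D.measurable_x n).add ((CadlagPath.measurable_val t).comp (D.measurable_X n))

theorem measurable_colored (t : ℝ≥0) : Measurable (D.colored t) :=
  measurable_mkColored.comp ((D.measurable_pos t).prodMk D.measurable_colors)

theorem measurable_sub (I : Finset ℕ) (t : ℝ≥0) : Measurable (D.sub I t) :=
  (measurable_finConfig I).comp (D.measurable_pos t)

theorem isPoissonProcess_start : IsPoissonProcess P fun ω => Set.range (D.start ω) := D.poisson

theorem ae_injective_start : ∀ᵐ ω ∂P, Function.Injective (D.start ω) := D.injective

theorem ae_start_mem_goodSeq : ∀ᵐ ω ∂P, D.start ω ∈ goodSeq :=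
  D.ae_injective_start.and D.isPoissonProcess_start.ae_locFinite

variable [IsProbabilityMeasure P] [IsProbabilityMeasure μ]

theorem map_start_colors_paths :
    P.map (fun ω => (D.start ω, (D.colors ω, D.paths ω))) =
      (P.map D.start).prod (coinSeq.prod (Measure.infinitePi fun _ => μ)) := by
  have : IsProbabilityMeasure (P.map D.start) :=
    Measure.isProbabilityMeasure_map D.measurable_start.aemeasurable
  have h := D.joint_law
  rw [← infinitePi_prod_map_unzip coin μ]
  conv_rhs => enter [1]; rw [← Measure.map_id (μ := P.map D.start)]
  rw [Measure.map_prod_map _ _ measurable_id (by fun_prop)]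
  have h' : (P.map D.start).prod (Measure.infinitePi fun _ : ℕ => coin.prod μ) =
    P.map (fun ω => ((fun n => D.x n ω), (fun n => (D.ε n ω, D.X n ω)))) := h.symm
  rw [h', Measure.map_map]
  · rfl
  · fun_prop
  · refine D.measurable_start.prodMk (measurable_pi_lambda _ fun n => ?_)
    exact (D.measurable_ε n).prodMk (D.measurable_X n)

theorem map_start_paths_colors :
    P.map (fun ω => ((D.start ω, D.paths ω), D.colors ω)) =
      ((P.map D.start).prod (Measure.infinitePi fun _ => μ)).prod coinSeq := by
  have : IsProbabilityMeasure (P.map D.start) :=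
    Measure.isProbabilityMeasure_map D.measurable_start.aemeasurable
  have h1 : MeasurePreserving (Prod.map id Prod.swap)
      ((P.map D.start).prod (coinSeq.prod (Measure.infinitePi fun _ : ℕ => μ)))
      ((P.map D.start).prod ((Measure.infinitePi fun _ : ℕ => μ).prod coinSeq)) :=
    (MeasurePreserving.id _).prod Measure.measurePreserving_swap
  have h2 := (measurePreserving_prodAssoc (P.map D.start) (Measure.infinitePi fun _ : ℕ => μ)
    coinSeq).symm
  have h3 := (h2.comp h1).map_eq
  rw [← map_start_colors_paths, Measure.map_map (h2.comp h1).measurable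
    (D.measurable_start.prodMk (D.measurable_colors.prodMk D.measurable_paths))] at h3
  exact h3

theorem map_start_paths :
    P.map (fun ω => (D.start ω, D.paths ω)) =
      (P.map D.start).prod (Measure.infinitePi fun _ => μ) := by
  have : IsProbabilityMeasure (P.map D.start) :=
    Measure.isProbabilityMeasure_map D.measurable_start.aemeasurable
  have h := congrArg (Measure.map Prod.fst) D.map_start_paths_colors
  rw [Measure.map_map measurable_fst ((D.measurable_start.prodMk D.measurable_paths).prodMk
    D.measurable_colors)] at h
  refine Eq.trans h ?_
  rw [Measure.map_fst_prod]
  simp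

/-- Given the positions and the trajectories, the colours are independent and uniform. -/
theorem integral_colors {F : ((ℕ → Plane) × (ℕ → CadlagPath)) → (ℕ → ℤˣ) → ℝ}
    (hF : Measurable (Function.uncurry F)) {C : ℝ} (hC : ∀ q c, |F q c| ≤ C) :
    ∫ ω, F (D.start ω, D.paths ω) (D.colors ω) ∂P =
      ∫ ω, ∫ c, F (D.start ω, D.paths ω) c ∂coinSeq ∂P := by
  have : IsProbabilityMeasure (P.map D.start) :=
    Measure.isProbabilityMeasure_map D.measurable_start.aemeasurable
  have hm1 := D.measurable_start.prodMk D.measurable_paths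
  have h1 : ∫ ω, F (D.start ω, D.paths ω) (D.colors ω) ∂P =
      ∫ r, Function.uncurry F r ∂(P.map fun ω => ((D.start ω, D.paths ω), D.colors ω)) :=
    (integral_map (hm1.prodMk D.measurable_colors).aemeasurable hF.aestronglyMeasurable).symm
  rw [h1, D.map_start_paths_colors,
    integral_prod _ (integrable_of_bounded hF fun r => hC r.1 r.2), ← D.map_start_paths,
    integral_map hm1.aemeasurable]
  · rfl
  · exact hF.stronglyMeasurable.integral_prod_right.aestronglyMeasurable

theorem lintegral_start_paths {F : (ℕ → Plane) × (ℕ → CadlagPath) → ℝ≥0∞} (hF : Measurable F) :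
    ∫⁻ ω, F (D.start ω, D.paths ω) ∂P =
      ∫⁻ q, F (D.start q.1, q.2) ∂(P.prod (Measure.infinitePi fun _ : ℕ => μ)) := by
  have h1 : (P.map D.start).prod (Measure.infinitePi fun _ : ℕ => μ) =
      (P.prod (Measure.infinitePi fun _ : ℕ => μ)).map (Prod.map D.start id) := by
    rw [← Measure.map_prod_map _ _ D.measurable_start measurable_id, Measure.map_id]
  rw [← lintegral_map hF (D.measurable_start.prodMk D.measurable_paths), D.map_start_paths, h1,
    lintegral_map hF (D.measurable_start.prodMap measurable_id)]
  rfl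

theorem ae_pos_zero (hμ : IsLevyLaw μ) : ∀ᵐ ω ∂P, D.pos 0 ω = D.start ω := by
  have hset : MeasurableSet {q : (ℕ → Plane) × (ℕ → CadlagPath) | ∀ n, (q.2 n).val 0 = 0} := by
    refine measurableSet_setOfPred.2 <| Measurable.forall fun n => measurableSet_setOfPred.1 ?_
    exact measurableSet_eq_fun ((CadlagPath.measurable_val 0).comp (by fun_prop)) measurable_const
  have h1 : ∀ᵐ z ∂(Measure.infinitePi fun _ : ℕ => μ), ∀ n, (z n).val 0 = 0 := by
    refine ae_all_iff.2 fun n => ?_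
    have := hμ.zero
    rw [← Measure.infinitePi_map_eval (fun _ : ℕ => μ) n] at this
    exact ae_of_ae_map (measurable_pi_apply n).aemeasurable this
  have : IsProbabilityMeasure (P.map D.start) :=
    Measure.isProbabilityMeasure_map D.measurable_start.aemeasurable
  have h2 : ∀ᵐ q ∂((P.map D.start).prod (Measure.infinitePi fun _ : ℕ => μ)),
      ∀ n, (q.2 n).val 0 = 0 := Measure.quasiMeasurePreserving_snd.ae h1
  rw [← D.map_start_paths] at h2
  filter_upwards [ae_of_ae_map (D.measurable_start.prodMk D.measurable_paths).aemeasurable h2]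
    with ω hω
  funext n
  have : (D.X n ω).val 0 = 0 := hω n
  simp [pos, start, this]

/-- The law of the initial positions and the positions at time `t`. -/
theorem lintegral_pos_forward (hμ : IsLevyLaw μ) (t : ℝ≥0) {Φ : (ℕ → Plane × Plane) → ℝ≥0∞}
    (hΦ : Measurable Φ) :
    ∫⁻ ω, Φ (fun n => (D.pos 0 ω n, D.pos t ω n)) ∂P =
      ∫⁻ q, Φ (fun n => (D.start q.1 n, D.start q.1 n + (q.2 n).val t))
        ∂(P.prod (Measure.infinitePi fun _ : ℕ => μ)) := by
  have hval : ∀ n, Measurable fun q : (ℕ → Plane) × (ℕ → CadlagPath) => (q.2 n).val t :=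
    fun n => (CadlagPath.measurable_val t).comp (by fun_prop)
  rw [← D.lintegral_start_paths (F := fun q => Φ fun n => (q.1 n, q.1 n + (q.2 n).val t))]
  · refine lintegral_congr_ae ?_
    filter_upwards [D.ae_pos_zero hμ] with ω hω
    rw [hω]
    rfl
  · exact hΦ.comp (by fun_prop)

/-- Reversibility: up to relabelling, the initial positions and the positions at time `t` are
obtained by displacing backwards the points of a Poisson process. -/
theorem lintegral_pos_backward (hμ : IsLevyLaw μ) (t : ℝ≥0) {Φ : (ℕ → Plane × Plane) → ℝ≥0∞}
    (hΦ : Measurable Φ)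
    (hΦ_perm : ∀ (π : Equiv.Perm ℕ) (y : ℕ → Plane × Plane), Φ (y ∘ π) = Φ y) :
    ∫⁻ ω, Φ (fun n => (D.pos 0 ω n, D.pos t ω n)) ∂P =
      ∫⁻ q, Φ (fun n => (D.start q.1 n + -(q.2 n).val t, D.start q.1 n))
        ∂(P.prod (Measure.infinitePi fun _ : ℕ => μ)) := by
  rw [D.lintegral_pos_forward hμ t hΦ,
    D.isPoissonProcess_start.lintegral_displaced D.measurable_start D.ae_injective_start
      (CadlagPath.measurable_val t) hΦ hΦ_perm]
  simp_rw [sub_eq_add_neg]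

theorem pairMeasure_eq_forward (hμ : IsLevyLaw μ) (t : ℝ≥0) :
    D.pairMeasure 0 t = displacedPairs P D.start μ fun f => f.val t := by
  rw [pairMeasure, displacedPairs]
  congr 1
  funext I
  refine Measure.ext fun C hC => ?_
  have hΦ : Measurable fun y : ℕ → Plane × Plane => C.indicator (1 : Config × Config → ℝ≥0∞)
      (finConfig (fun n => (y n).1) I, finConfig (fun n => (y n).2) I) :=
    (measurable_one.indicator hC).comp
      (((measurable_finConfig I).comp (by fun_prop)).prodMk
        ((measurable_finConfig I).comp (by fun_prop)))
  have h := D.lintegral_pos_forward hμ t hΦ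
  have hm1 := (D.measurable_sub I 0).prodMk (D.measurable_sub I t)
  have hm2 := measurable_displacedPairs_fun (M := CadlagPath) D.measurable_start
    (CadlagPath.measurable_val t) I
  rw [← lintegral_indicator_one hC, ← lintegral_indicator_one hC,
    lintegral_map (measurable_one.indicator hC) hm1,
    lintegral_map (measurable_one.indicator hC) hm2]
  exact h

/-- Unlike in the forward case, a single label set cannot be treated alone: reversibility holds up
to relabelling, and only the sum over all label sets is invariant. -/
theorem pairMeasure_eq_backward (hμ : IsLevyLaw μ) (t : ℝ≥0) :
    D.pairMeasure t 0 = displacedPairs P D.start μ fun f => -f.val t := by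
  refine Measure.ext fun C hC => ?_
  have hΦI : ∀ I, Measurable fun y : ℕ → Plane × Plane =>
      C.indicator (1 : Config × Config → ℝ≥0∞)
      (finConfig (fun n => (y n).2) I, finConfig (fun n => (y n).1) I) := fun I =>
    (measurable_one.indicator hC).comp
      (((measurable_finConfig I).comp (by fun_prop)).prodMk
        ((measurable_finConfig I).comp (by fun_prop)))
  have h := D.lintegral_pos_backward hμ t (Measurable.tsum hΦI) fun π y => by
    conv_rhs => rw [← (Equiv.finsetCongr π).tsum_eq]
    refine tsum_congr fun I => ?_
    rw [Equiv.finsetCongr_apply, ← finConfig_comp_perm, ← finConfig_comp_perm]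
    rfl
  have hm1 := fun I => (D.measurable_sub I t).prodMk (D.measurable_sub I 0)
  have hm2 := measurable_displacedPairs_fun (M := CadlagPath) D.measurable_start
    (CadlagPath.measurable_val t).neg
  rw [← lintegral_indicator_one hC, ← lintegral_indicator_one hC, pairMeasure, displacedPairs,
    lintegral_sum_measure, lintegral_sum_measure]
  rw [lintegral_tsum, lintegral_tsum] at h
  · exact (tsum_congr fun I => lintegral_map (measurable_one.indicator hC) (hm1 I)).trans
      (h.trans (tsum_congr fun I => (lintegral_map (measurable_one.indicator hC) (hm2 I)).symm))
  · exact fun I => ((measurable_one.indicator hC).comp (hm2 I)).aemeasurable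
  · exact fun I => ((measurable_one.indicator hC).comp (hm1 I)).aemeasurable

end MuDynamics

/-! ### Spectral masses along the dynamics -/

/-- The squared Fourier coefficient of `h` at the set of the points with label in `I`. -/
noncomputable def labelWeight (h : ColConfig → ℝ) (p : ℕ → Plane) (I : Finset ℕ) : ℝ≥0∞ :=
  ENNReal.ofReal (labelCoeff h p I ^ 2)

theorem measurable_labelWeight (h_meas : Measurable h) (I : Finset ℕ) :
    Measurable fun p => labelWeight h p I :=
  ((measurable_labelCoeff h_meas I).pow_const 2).ennreal_ofReal

theorem labelWeight_comp_perm (h_meas : Measurable h) (p : ℕ → Plane) (π : Equiv.Perm ℕ)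
    (I : Finset ℕ) : labelWeight h (p ∘ π) I = labelWeight h p (I.map π.toEmbedding) := by
  rw [labelWeight, labelCoeff_comp_perm h_meas, labelWeight]

namespace MuDynamics

variable {Ω₀ : Type*} [MeasurableSpace Ω₀] {P : Measure Ω₀} {μ : Measure CadlagPath}
  (D : MuDynamics P μ) [IsProbabilityMeasure P] [IsProbabilityMeasure μ]

theorem ae_points_zero (hμ : IsLevyLaw μ) :
    ∀ᵐ ω ∂P, ∃ hp : D.pos 0 ω ∈ goodSeq, D.points 0 ω = ⟨Set.range (D.pos 0 ω), hp.2⟩ := by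
  filter_upwards [D.ae_pos_zero hμ, D.ae_start_mem_goodSeq] with ω h1 h2
  rw [← h1] at h2
  exact ⟨h2, mkColored_pts h2 _⟩

theorem lintegral_spectral_zero (hμ : IsLevyLaw μ) (h_meas : Measurable h) (A : Set Config) :
    ∫⁻ ω, ∑' I, labelWeight h (D.pos 0 ω) I * A.indicator 1 (finConfig (D.pos 0 ω) I) ∂P =
      annealedSpectral P (D.points 0) h A := by
  refine lintegral_congr_ae ?_
  filter_upwards [D.ae_points_zero hμ] with ω ⟨hp, hω⟩
  rw [hω, quenchedSpectral_range hp h_meas]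
  rfl

theorem lintegral_spectral_start (hμ : IsLevyLaw μ) (h_meas : Measurable h) (A : Set Config) :
    ∫⁻ ω, ∑' I, labelWeight h (D.start ω) I * A.indicator 1 (finConfig (D.start ω) I) ∂P =
      annealedSpectral P (D.points 0) h A := by
  rw [← D.lintegral_spectral_zero hμ h_meas]
  refine lintegral_congr_ae ?_
  filter_upwards [D.ae_pos_zero hμ] with ω hω
  rw [hω]

/-- The processes of the points at time `t` and at time `0` have the same law. -/
theorem lintegral_pos_stationary (hμ : IsLevyLaw μ) (t : ℝ≥0) {Φ : (ℕ → Plane) → ℝ≥0∞}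
    (hΦ : Measurable Φ)
    (hΦ_perm : ∀ (π : Equiv.Perm ℕ) (y : ℕ → Plane), Φ (y ∘ π) = Φ y) :
    ∫⁻ ω, Φ (D.pos t ω) ∂P = ∫⁻ ω, Φ (D.pos 0 ω) ∂P := by
  have h1 : ∫⁻ ω, Φ (D.pos 0 ω) ∂P = ∫⁻ ω, Φ (D.start ω) ∂P := by
    refine lintegral_congr_ae ?_
    filter_upwards [D.ae_pos_zero hμ] with ω hω
    rw [hω]
  have hm : Measurable fun q : Ω₀ × (ℕ → CadlagPath) => Φ (D.start q.1) :=
    hΦ.comp (D.measurable_start.comp measurable_fst)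
  have h2 : ∫⁻ q, Φ (D.start q.1) ∂(P.prod (Measure.infinitePi fun _ : ℕ => μ)) =
      ∫⁻ ω, Φ (D.start ω) ∂P := by
    rw [lintegral_prod _ hm.aemeasurable]
    simp
  rw [h1, ← h2]
  exact D.lintegral_pos_backward hμ t (Φ := fun y => Φ fun n => (y n).2)
    (hΦ.comp (by fun_prop)) fun π y => hΦ_perm π fun n => (y n).2

/-- A permutation of the labels moves the coefficient and the set together, so the sum is invariant
and stationarity applies. -/
theorem lintegral_spectral (hμ : IsLevyLaw μ) (h_meas : Measurable h) (t : ℝ≥0) {A : Set Config}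
    (hA : MeasurableSet A) :
    ∫⁻ ω, ∑' I, labelWeight h (D.pos t ω) I * A.indicator 1 (finConfig (D.pos t ω) I) ∂P =
      annealedSpectral P (D.points 0) h A := by
  rw [← D.lintegral_spectral_zero hμ h_meas]
  refine D.lintegral_pos_stationary hμ t (Φ := fun p =>
    ∑' I, labelWeight h p I * A.indicator 1 (finConfig p I)) ?_ fun π y => ?_
  · exact Measurable.tsum fun I => (measurable_labelWeight h_meas I).mul
      (measurable_indicator_finConfig hA measurable_id I)
  · conv_rhs => rw [← (Equiv.finsetCongr π).tsum_eq]
    refine tsum_congr fun I => ?_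
    rw [Equiv.finsetCongr_apply, labelWeight_comp_perm h_meas, finConfig_comp_perm]

theorem lintegral_spectral_pair_le (hμ : IsLevyLaw μ) (h_meas : Measurable h) (t : ℝ≥0)
    {A : Set Config} (hA : MeasurableSet A) {κ : Kernel Config Config} (hκ : D.IsCondLaw 0 t κ)
    {δ : ℝ≥0∞} (hδ : ∀ S ∈ A, κ S A ≤ δ) :
    ∫⁻ ω, ∑' I, labelWeight h (D.pos 0 ω) I * A.indicator 1 (finConfig (D.pos 0 ω) I) *
        A.indicator 1 (finConfig (D.pos t ω) I) ∂P ≤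
      δ * annealedSpectral P (D.points 0) h A := by
  have : IsMarkovKernel κ := hκ.1
  have hκ' := hκ.2
  rw [D.pairMeasure_eq_forward hμ t] at hκ'
  have hle := lintegral_displaced_le D.measurable_start D.ae_injective_start
    D.isPoissonProcess_start (CadlagPath.measurable_val t) hκ' hA hδ
    (w := fun I ω => labelWeight h (D.start ω) I)
    fun I => (measurable_labelWeight h_meas I).comp D.measurable_start
  rw [D.lintegral_spectral_start hμ h_meas] at hle
  refine le_trans (le_of_eq ?_) hle
  refine D.lintegral_pos_forward hμ t (Φ := fun y => ∑' I, labelWeight h (fun n => (y n).1) I *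
    A.indicator 1 (finConfig (fun n => (y n).1) I) *
      A.indicator 1 (finConfig (fun n => (y n).2) I)) ?_
  exact Measurable.tsum fun I => (((measurable_labelWeight h_meas I).comp (by fun_prop)).mul
    (measurable_indicator_finConfig hA (by fun_prop) I)).mul
      (measurable_indicator_finConfig hA (by fun_prop) I)

/-- By reversibility, the configuration at time `t` serves as the Poisson process and the one at
time 0 as its displacement by the opposite increments; the weights now sit at the undisplaced end.
-/
theorem lintegral_spectral_pair_le' (hμ : IsLevyLaw μ) (h_meas : Measurable h) (t : ℝ≥0)
    {A : Set Config} (hA : MeasurableSet A) {κ : Kernel Config Config} (hκ : D.IsCondLaw t 0 κ)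
    {δ : ℝ≥0∞} (hδ : ∀ S ∈ A, κ S A ≤ δ) :
    ∫⁻ ω, ∑' I, labelWeight h (D.pos t ω) I * A.indicator 1 (finConfig (D.pos t ω) I) *
        A.indicator 1 (finConfig (D.pos 0 ω) I) ∂P ≤
      δ * annealedSpectral P (D.points 0) h A := by
  have : IsMarkovKernel κ := hκ.1
  have hκ' := hκ.2
  rw [D.pairMeasure_eq_backward hμ t] at hκ'
  have hle := lintegral_displaced_le D.measurable_start D.ae_injective_start
    D.isPoissonProcess_start (CadlagPath.measurable_val t).neg hκ' hA hδ
    (w := fun I ω => labelWeight h (D.start ω) I)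
    fun I => (measurable_labelWeight h_meas I).comp D.measurable_start
  rw [D.lintegral_spectral_start hμ h_meas] at hle
  refine le_trans (le_of_eq ?_) hle
  refine D.lintegral_pos_backward hμ t (Φ := fun y => ∑' I, labelWeight h (fun n => (y n).2) I *
    A.indicator 1 (finConfig (fun n => (y n).2) I) *
      A.indicator 1 (finConfig (fun n => (y n).1) I)) ?_ fun π y => ?_
  · exact Measurable.tsum fun I => (((measurable_labelWeight h_meas I).comp (by fun_prop)).mul
      (measurable_indicator_finConfig hA (by fun_prop) I)).mul
        (measurable_indicator_finConfig hA (by fun_prop) I)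
  · conv_rhs => rw [← (Equiv.finsetCongr π).tsum_eq]
    refine tsum_congr fun I => ?_
    rw [Equiv.finsetCongr_apply, ← labelWeight_comp_perm h_meas, ← finConfig_comp_perm,
      ← finConfig_comp_perm]
    rfl

end MuDynamics

/-! ### The covariance bound -/

/-- Weighted AM-GM, used in place of Cauchy–Schwarz so that it can be applied term by term before
taking expectations. -/
theorem ofReal_abs_mul_le {c : ℝ} (hc : 0 < c) (a b : ℝ) :
    ENNReal.ofReal |a * b| ≤ 2⁻¹ * (ENNReal.ofReal c⁻¹ * ENNReal.ofReal (a ^ 2) +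
      ENNReal.ofReal c * ENNReal.ofReal (b ^ 2)) := by
  have h2 : (2⁻¹ : ℝ≥0∞) = ENNReal.ofReal 2⁻¹ := by
    rw [ENNReal.ofReal_inv_of_pos (by norm_num)]; simp
  rw [h2, ← ENNReal.ofReal_mul (by positivity), ← ENNReal.ofReal_mul hc.le,
    ← ENNReal.ofReal_add (by positivity) (by positivity), ← ENNReal.ofReal_mul (by norm_num)]
  refine ENNReal.ofReal_le_ofReal ?_
  have hs : √c ^ 2 = c := Real.sq_sqrt hc.le
  have hpos : 0 < √c := Real.sqrt_pos.2 hc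
  have key := sq_nonneg ((√c)⁻¹ * |a| - √c * |b|)
  have e1 : ((√c)⁻¹ * |a| - √c * |b|) ^ 2 = c⁻¹ * a ^ 2 + c * b ^ 2 - 2 * (|a| * |b|) := by
    rw [sub_sq, mul_pow, mul_pow, inv_pow, hs, sq_abs, sq_abs]
    field_simp
    ring
  rw [abs_mul]
  linarith

theorem integral_le_lintegral_ofReal {α : Type*} [MeasurableSpace α] {m : Measure α} {g : α → ℝ}
    (hg : Integrable g m) :
    ((∫ a, g a ∂m : ℝ) : EReal) ≤ ((∫⁻ a, ENNReal.ofReal (g a) ∂m : ℝ≥0∞) : EReal) := by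
  have hfin : ∫⁻ a, ENNReal.ofReal (g a) ∂m ≠ ∞ := hg.lintegral_lt_top.ne
  rw [← EReal.coe_ennreal_toReal hfin, EReal.coe_le_coe_iff,
    integral_eq_lintegral_pos_part_sub_lintegral_neg_part hg]
  linarith [ENNReal.toReal_nonneg (a := ∫⁻ a, ENNReal.ofReal (-g a) ∂m)]

theorem mass_diff_le {qA qB qD : ℝ≥0∞} {δ : ℝ} (hadd : qA + qD = qB)
    (hA : ENNReal.ofReal (1 - δ) * qB ≤ qA) (hB : qB ≠ ∞) :
    qD ≤ ENNReal.ofReal δ * qB := by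
  have hqA : qA ≠ ∞ := ne_top_of_le_ne_top hB (hadd ▸ le_self_add)
  -- An inequality is enough, and it also covers δ > 1, where the first summand is truncated to 0.
  have h1 : (1 : ℝ≥0∞) ≤ ENNReal.ofReal (1 - δ) + ENNReal.ofReal δ := by
    have := ENNReal.ofReal_add_le (p := 1 - δ) (q := δ)
    simpa using this
  refine (ENNReal.add_le_add_iff_left hqA).1 ?_
  calc qA + qD = 1 * qB := by rw [hadd, one_mul]
    _ ≤ (ENNReal.ofReal (1 - δ) + ENNReal.ofReal δ) * qB := by gcongr
    _ = ENNReal.ofReal (1 - δ) * qB + ENNReal.ofReal δ * qB := add_mul _ _ _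
    _ ≤ qA + ENNReal.ofReal δ * qB := by gcongr

/-- Bound of the contribution of one class `B` of sets to the covariance; `u` and `v`
stand for the initial and the final set. -/
theorem indicator_mul_ofReal_abs_le {A B : Set Config} {u v : Config}
    (huv : u ∈ B ↔ v ∈ B) {c : ℝ} (hc : 0 < c) (a b : ℝ) :
    B.indicator (1 : Config → ℝ≥0∞) u * ENNReal.ofReal |a * b| ≤
      2⁻¹ * (ENNReal.ofReal (a ^ 2) * A.indicator 1 u * A.indicator 1 v +
        ENNReal.ofReal (b ^ 2) * A.indicator 1 v * A.indicator 1 u) +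
      (2⁻¹ * (ENNReal.ofReal c⁻¹ * (ENNReal.ofReal (a ^ 2) * (B \ A).indicator 1 u) +
        ENNReal.ofReal c * (ENNReal.ofReal (b ^ 2) * B.indicator 1 v)) +
      2⁻¹ * (ENNReal.ofReal c * (ENNReal.ofReal (a ^ 2) * B.indicator 1 u) +
        ENNReal.ofReal c⁻¹ * (ENNReal.ofReal (b ^ 2) * (B \ A).indicator 1 v))) := by
  by_cases hu : u ∈ B
  · have hv : v ∈ B := huv.1 hu
    rw [Set.indicator_of_mem hu, Set.indicator_of_mem hv]
    -- Both sets in `A`: weight 1. Otherwise the square attached to a set in B \ A receives c⁻¹, to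
    -- be compensated by the small mass of B \ A, and the other square receives `c`.
    by_cases hAu : u ∈ A
    · by_cases hAv : v ∈ A
      · refine le_trans ?_ le_self_add
        have := ofReal_abs_mul_le one_pos a b
        simpa [hAu, hAv] using this
      · refine le_trans ?_ (le_add_left le_add_self)
        rw [Set.indicator_of_mem (Set.mem_sdiff_of_mem hv hAv)]
        have := ofReal_abs_mul_le hc b a
        rw [add_comm, mul_comm b a] at this
        simpa using this
    · refine le_trans ?_ (le_add_left le_self_add)
      rw [Set.indicator_of_mem (Set.mem_sdiff_of_mem hu hAu)]
      have := ofReal_abs_mul_le hc a b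
      simpa using this
  · rw [Set.indicator_of_notMem hu, zero_mul]
    exact zero_le

theorem lintegral_const_mul_add {Ω₀ : Type*} [MeasurableSpace Ω₀] {P : Measure Ω₀}
    {f g : Ω₀ → ℝ≥0∞} (hf : Measurable f) (hg : Measurable g) (k c d : ℝ≥0∞) :
    ∫⁻ ω, k * (c * f ω + d * g ω) ∂P = k * (c * ∫⁻ ω, f ω ∂P + d * ∫⁻ ω, g ω ∂P) := by
  have hcf : Measurable fun ω => c * f ω := hf.const_mul c
  have hdg : Measurable fun ω => d * g ω := hg.const_mul d
  have hsum : Measurable fun ω => c * f ω + d * g ω := hcf.add hdg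
  rw [lintegral_const_mul _ hsum, lintegral_add_left hcf, lintegral_const_mul _ hf,
    lintegral_const_mul _ hg]

namespace MuDynamics

variable {Ω₀ : Type*} [MeasurableSpace Ω₀] {P : Measure Ω₀} {μ : Measure CadlagPath}
  (D : MuDynamics P μ) [IsProbabilityMeasure P]

theorem integrable_mul_colored (h_meas : Measurable h) {C : ℝ} (hC : ∀ w, |h w| ≤ C) (t : ℝ≥0) :
    Integrable (fun ω => h (D.colored 0 ω) * h (D.colored t ω)) P := by
  refine integrable_of_bounded ((h_meas.comp (D.measurable_colored 0)).mul
    (h_meas.comp (D.measurable_colored t))) (C := C * C) fun ω => ?_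
  rw [abs_mul]
  exact mul_le_mul (hC _) (hC _) (abs_nonneg _) ((abs_nonneg _).trans (hC (D.colored 0 ω)))

theorem integrable_labelCoeff_sq (h_meas : Measurable h) {C : ℝ} (hC : ∀ w, |h w| ≤ C) (t : ℝ≥0) :
    Integrable (fun ω => labelCoeff h (D.pos t ω) ∅ ^ 2) P := by
  refine integrable_of_bounded (((measurable_labelCoeff h_meas ∅).comp
    (D.measurable_pos t)).pow_const 2) (C := C ^ 2) fun ω => ?_
  rw [abs_pow]
  exact pow_le_pow_left₀ (abs_nonneg _) (abs_labelCoeff_le hC _ _) 2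

variable [IsProbabilityMeasure μ]

/-- The contribution to the covariance of a class `B` of sets that is stable under the dynamics. -/
theorem lintegral_class_le (hμ : IsLevyLaw μ) (h_meas : Measurable h) (t : ℝ≥0)
    {A B : Set Config} (hA : MeasurableSet A) (hB : MeasurableSet B) (hAB : A ⊆ B)
    (hB_inv : ∀ᵐ ω ∂P, ∀ I : Finset ℕ, D.sub I 0 ω ∈ B ↔ D.sub I t ω ∈ B)
    {δ₁ δ₂ : ℝ} (hδ₁ : 0 < δ₁) (hδ₂ : 0 < δ₂) {κ κ' : Kernel Config Config}
    (hκ : D.IsCondLaw 0 t κ) (hκ' : D.IsCondLaw t 0 κ')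
    (hi : ∀ S ∈ A, κ S A ≤ ENNReal.ofReal δ₁) (hii : ∀ S ∈ A, κ' S A ≤ ENNReal.ofReal δ₁)
    (hiii : ENNReal.ofReal (1 - δ₂) * annealedSpectral P (D.points 0) h B ≤
      annealedSpectral P (D.points 0) h A) :
    ∫⁻ ω, ∑' I, B.indicator 1 (finConfig (D.pos 0 ω) I) *
        ENNReal.ofReal |labelCoeff h (D.pos 0 ω) I * labelCoeff h (D.pos t ω) I| ∂P ≤
      annealedSpectral P (D.points 0) h B * ENNReal.ofReal (δ₁ + 2 * √δ₂) := by
  set q : Set Config → ℝ≥0∞ := annealedSpectral P (D.points 0) h with hq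
  have hc : 0 < √δ₂ := Real.sqrt_pos.2 hδ₂
  -- With infinite mass the right side is ∞, as its other factor is positive; finiteness is needed
  -- below to subtract masses.
  by_cases hBtop : q B = ∞
  · rw [hBtop, ENNReal.top_mul]
    · exact le_top
    · exact (ENNReal.ofReal_pos.2 (by positivity)).ne'
  let a : ℝ≥0 → Set Config → Finset ℕ → Ω₀ → ℝ≥0∞ := fun r K I ω =>
    labelWeight h (D.pos r ω) I * K.indicator 1 (finConfig (D.pos r ω) I)
  let b : ℝ≥0 → ℝ≥0 → Finset ℕ → Ω₀ → ℝ≥0∞ := fun r r' I ω =>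
    a r A I ω * A.indicator 1 (finConfig (D.pos r' ω) I)
  have ha : ∀ r K, MeasurableSet K → ∀ I, Measurable (a r K I) := fun r K hK I =>
    ((measurable_labelWeight h_meas I).comp (D.measurable_pos r)).mul
      (measurable_indicator_finConfig hK (D.measurable_pos r) I)
  have hb : ∀ r r' I, Measurable (b r r' I) := fun r r' I =>
    (ha r A hA I).mul (measurable_indicator_finConfig hA (D.measurable_pos r') I)
  have hat : ∀ r K, MeasurableSet K → Measurable fun ω => ∑' I, a r K I ω :=
    fun r K hK => Measurable.tsum (ha r K hK)
  have hbt : ∀ r r', Measurable fun ω => ∑' I, b r r' I ω := fun r r' => Measurable.tsum (hb r r')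
  have hq_int : ∀ r K, MeasurableSet K → ∫⁻ ω, ∑' I, a r K I ω ∂P = q K :=
    fun r K hK => D.lintegral_spectral hμ h_meas r hK
  have hBA := hB.diff hA
  have hadd : q A + q (B \ A) = q B := by
    rw [← hq_int 0 A hA, ← hq_int 0 _ hBA, ← hq_int 0 B hB, ← lintegral_add_left (hat 0 A hA)]
    refine lintegral_congr fun ω => ?_
    rw [← ENNReal.tsum_add]
    refine tsum_congr fun I => ?_
    simp only [a]
    rw [← mul_add]
    congr 1
    by_cases hu : finConfig (D.pos 0 ω) I ∈ A
    · simp [hu, hAB hu]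
    · by_cases hv : finConfig (D.pos 0 ω) I ∈ B <;> simp [hu, hv]
  have hqA : q A ≤ q B := hadd ▸ le_self_add
  have hdiff : q (B \ A) ≤ ENNReal.ofReal δ₂ * q B := mass_diff_le hadd hiii hBtop
  have h0t : ∫⁻ ω, ∑' I, b 0 t I ω ∂P ≤ ENNReal.ofReal δ₁ * q B :=
    (D.lintegral_spectral_pair_le hμ h_meas t hA hκ hi).trans (by gcongr)
  have ht0 : ∫⁻ ω, ∑' I, b t 0 I ω ∂P ≤ ENNReal.ofReal δ₁ * q B :=
    (D.lintegral_spectral_pair_le' hμ h_meas t hA hκ' hii).trans (by gcongr)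
  set c := ENNReal.ofReal √δ₂ with hcdef
  set d := ENNReal.ofReal (√δ₂)⁻¹ with hddef
  -- This balance dictates the weight √δ₂: both squares in a mixed case then contribute √δ₂ q(B),
  -- half of each is kept, and the two mixed cases add up to 2√δ₂ q(B).
  have hdc : d * ENNReal.ofReal δ₂ = c := by
    rw [hddef, ← ENNReal.ofReal_mul (by positivity), hcdef]
    congr 1
    rw [inv_mul_eq_div, Real.div_sqrt]
  calc ∫⁻ ω, ∑' I, B.indicator 1 (finConfig (D.pos 0 ω) I) *
        ENNReal.ofReal |labelCoeff h (D.pos 0 ω) I * labelCoeff h (D.pos t ω) I| ∂P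
      ≤ ∫⁻ ω, (2⁻¹ * (∑' I, b 0 t I ω + ∑' I, b t 0 I ω) +
          (2⁻¹ * (d * ∑' I, a 0 (B \ A) I ω + c * ∑' I, a t B I ω) +
            2⁻¹ * (c * ∑' I, a 0 B I ω + d * ∑' I, a t (B \ A) I ω))) ∂P := by
        refine lintegral_mono_ae ?_
        filter_upwards [hB_inv] with ω hω
        simp only [← ENNReal.tsum_mul_left, ← ENNReal.tsum_add]
        exact ENNReal.tsum_le_tsum fun I => indicator_mul_ofReal_abs_le (hω I) hc _ _
    _ = 2⁻¹ * (∫⁻ ω, ∑' I, b 0 t I ω ∂P + ∫⁻ ω, ∑' I, b t 0 I ω ∂P) +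
          (2⁻¹ * (d * q (B \ A) + c * q B) + 2⁻¹ * (c * q B + d * q (B \ A))) := by
        have h1 := lintegral_const_mul_add (P := P) (hbt 0 t) (hbt t 0) 2⁻¹ 1 1
        have h2 := lintegral_const_mul_add (P := P) (hat 0 _ hBA) (hat t _ hB) 2⁻¹ d c
        have h3 := lintegral_const_mul_add (P := P) (hat 0 _ hB) (hat t _ hBA) 2⁻¹ c d
        simp only [one_mul] at h1
        rw [hq_int 0 _ hBA, hq_int t _ hB] at h2
        rw [hq_int 0 _ hB, hq_int t _ hBA] at h3
        have m1 : Measurable fun ω => 2⁻¹ * (∑' I, b 0 t I ω + ∑' I, b t 0 I ω) :=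
          ((hbt 0 t).add (hbt t 0)).const_mul _
        have m2 : Measurable fun ω =>
            2⁻¹ * (d * ∑' I, a 0 (B \ A) I ω + c * ∑' I, a t B I ω) :=
          (((hat 0 _ hBA).const_mul _).add ((hat t _ hB).const_mul _)).const_mul _
        rw [lintegral_add_left m1, lintegral_add_left m2, h1, h2, h3]
    _ ≤ 2⁻¹ * (ENNReal.ofReal δ₁ * q B + ENNReal.ofReal δ₁ * q B) +
          (2⁻¹ * (d * (ENNReal.ofReal δ₂ * q B) + c * q B) +
            2⁻¹ * (c * q B + d * (ENNReal.ofReal δ₂ * q B))) := by gcongr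
    _ = q B * ENNReal.ofReal (δ₁ + 2 * √δ₂) := by
        have half : ∀ y : ℝ≥0∞, 2⁻¹ * (y + y) = y := fun y => by
          rw [← two_mul, ← mul_assoc, ENNReal.inv_mul_cancel (by simp) (by simp), one_mul]
        rw [← mul_assoc d, hdc, half, half, ENNReal.ofReal_add hδ₁.le (by positivity),
          ENNReal.ofReal_mul (by norm_num), ← hcdef, ENNReal.ofReal_ofNat]
        ring

theorem ae_quenchedExp_eq (hμ : IsLevyLaw μ) (h_meas : Measurable h) :
    ∀ᵐ ω ∂P, quenchedExp h (D.points 0 ω) = labelCoeff h (D.pos 0 ω) ∅ := by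
  filter_upwards [D.ae_points_zero hμ] with ω ⟨hp, hω⟩
  rw [hω, quenchedExp_range hp h_meas]

theorem integral_labelCoeff_sq (hμ : IsLevyLaw μ) (h_meas : Measurable h) (t : ℝ≥0) :
    ∫ ω, labelCoeff h (D.pos t ω) ∅ ^ 2 ∂P = ∫ ω, labelCoeff h (D.pos 0 ω) ∅ ^ 2 ∂P := by
  have hm : ∀ r, AEStronglyMeasurable (fun ω => labelCoeff h (D.pos r ω) ∅ ^ 2) P := fun r =>
    (((measurable_labelCoeff h_meas ∅).comp (D.measurable_pos r)).pow_const 2).aestronglyMeasurable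
  rw [integral_eq_lintegral_of_nonneg_ae (.of_forall fun ω => sq_nonneg _) (hm t),
    integral_eq_lintegral_of_nonneg_ae (.of_forall fun ω => sq_nonneg _) (hm 0)]
  congr 1
  refine D.lintegral_pos_stationary hμ t (Φ := fun p => labelWeight h p ∅)
    (measurable_labelWeight h_meas ∅) fun π y => ?_
  rw [labelWeight_comp_perm h_meas, Finset.map_empty]

/-- The covariance is an expectation of sums of products of Fourier coefficients. -/
theorem integral_mul_colored_le (hμ : IsLevyLaw μ) (h_meas : Measurable h) {C : ℝ}
    (hC : ∀ w, |h w| ≤ C)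
    (h_fin : ∀ᵐ ω ∂P, ∃ F : Finset (D.points 0 ω).carrier,
      DependsOn (restrictTo h (D.points 0 ω)) (F : Set (D.points 0 ω).carrier)) (t : ℝ≥0) :
    ((∫ ω, h (D.colored 0 ω) * h (D.colored t ω) ∂P : ℝ) : EReal) ≤
      ((∫ ω, quenchedExp h (D.points 0 ω) ^ 2 ∂P : ℝ) : EReal) +
      ((∫⁻ ω, ∑' I : Finset ℕ, (if I = ∅ then 0 else
        ENNReal.ofReal |labelCoeff h (D.pos 0 ω) I * labelCoeff h (D.pos t ω) I|) ∂P : ℝ≥0∞) :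
          EReal) := by
  let F : (ℕ → Plane) × (ℕ → CadlagPath) → (ℕ → ℤˣ) → ℝ := fun q c =>
    h (mkColored (fun n => q.1 n + (q.2 n).val 0) c) *
      h (mkColored (fun n => q.1 n + (q.2 n).val t) c)
  have hshift : ∀ r : ℝ≥0, Measurable fun q : (ℕ → Plane) × (ℕ → CadlagPath) =>
      fun n => q.1 n + (q.2 n).val r := by
    intro r
    have hval : ∀ n, Measurable fun q : (ℕ → Plane) × (ℕ → CadlagPath) => (q.2 n).val r :=
      fun n => (CadlagPath.measurable_val r).comp (by fun_prop)
    fun_prop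
  have hFr : ∀ r : ℝ≥0, Measurable fun q : ((ℕ → Plane) × (ℕ → CadlagPath)) × (ℕ → ℤˣ) =>
      h (mkColored (fun n => q.1.1 n + (q.1.2 n).val r) q.2) := fun r =>
    h_meas.comp (measurable_mkColored.comp
      (((hshift r).comp measurable_fst).prodMk measurable_snd))
  have hF : Measurable (Function.uncurry F) := (hFr 0).mul (hFr t)
  have hFC : ∀ q c, |F q c| ≤ C * C := fun q c => by
    rw [abs_mul]
    exact mul_le_mul (hC _) (hC _) (abs_nonneg _) ((abs_nonneg _).trans (hC (mkColored q.1 c)))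
  let inner : Ω₀ → ℝ := fun ω =>
    ∫ c, h (mkColored (D.pos 0 ω) c) * h (mkColored (D.pos t ω) c) ∂coinSeq
  have hcov : ∫ ω, h (D.colored 0 ω) * h (D.colored t ω) ∂P = ∫ ω, inner ω ∂P :=
    D.integral_colors hF hFC
  have hinner : Integrable inner P := by
    have hm : Measurable fun q => ∫ c, F q c ∂coinSeq :=
      hF.stronglyMeasurable.integral_prod_right.measurable
    refine integrable_of_bounded
      (hm.comp (D.measurable_start.prodMk D.measurable_paths)) (C := C * C) fun ω => ?_
    have := norm_integral_le_of_norm_le_const (μ := coinSeq)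
      (f := fun c => F (D.start ω, D.paths ω) c) (C := C * C) (.of_forall fun c => hFC _ c)
    exact (show |inner ω| ≤ _ from this).trans (by simp)
  -- This dominates the product of the two coefficients at the empty set, and by stationarity its
  -- mean is that of the squared quenched expectation.
  let e : Ω₀ → ℝ := fun ω =>
    (labelCoeff h (D.pos 0 ω) ∅ ^ 2 + labelCoeff h (D.pos t ω) ∅ ^ 2) / 2
  have he : Integrable e P :=
    ((D.integrable_labelCoeff_sq h_meas hC 0).add (D.integrable_labelCoeff_sq h_meas hC t)).div_const 2
  have he_int : ∫ ω, e ω ∂P = ∫ ω, quenchedExp h (D.points 0 ω) ^ 2 ∂P := by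
    have h1 : ∫ ω, quenchedExp h (D.points 0 ω) ^ 2 ∂P =
        ∫ ω, labelCoeff h (D.pos 0 ω) ∅ ^ 2 ∂P := by
      refine integral_congr_ae ?_
      filter_upwards [D.ae_quenchedExp_eq hμ h_meas] with ω hω
      rw [hω]
    rw [h1, integral_div, integral_add (D.integrable_labelCoeff_sq h_meas hC 0)
      (D.integrable_labelCoeff_sq h_meas hC t), D.integral_labelCoeff_sq hμ h_meas t]
    ring
  have hsplit : ∫ ω, inner ω ∂P = ∫ ω, e ω ∂P + ∫ ω, (inner ω - e ω) ∂P := by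
    rw [integral_sub hinner he]
    ring
  rw [hcov, hsplit, he_int, EReal.coe_add]
  -- Passing to the positive part moves the remaining sum into extended non-negative reals, where no
  -- summability is needed.
  refine add_le_add le_rfl ((integral_le_lintegral_ofReal (hinner.sub he)).trans ?_)
  refine EReal.coe_ennreal_le_coe_ennreal_iff.2 (lintegral_mono_ae ?_)
  filter_upwards [D.ae_points_zero hμ, h_fin] with ω ⟨hp, hω⟩ hfin
  rw [hω] at hfin
  obtain ⟨G, hG⟩ := hfin
  obtain ⟨J, hJ⟩ := exists_dependsOn_labels hp hG
  have hexp : inner ω = ∑ I ∈ J.powerset,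
      labelCoeff h (D.pos 0 ω) I * labelCoeff h (D.pos t ω) I :=
    integral_mul_eq_sum_walshCoeff (measurable_comp_mkColored h_meas _)
      (measurable_comp_mkColored h_meas _) (fun c => hC _) (fun c => hC _) hJ
  rw [← Finset.add_sum_erase _ _ (Finset.empty_mem_powerset J)] at hexp
  have hle : inner ω - e ω ≤ ∑ I ∈ J.powerset.erase ∅,
      |labelCoeff h (D.pos 0 ω) I * labelCoeff h (D.pos t ω) I| := by
    have h1 : labelCoeff h (D.pos 0 ω) ∅ * labelCoeff h (D.pos t ω) ∅ ≤ e ω := by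
      have := sq_nonneg (labelCoeff h (D.pos 0 ω) ∅ - labelCoeff h (D.pos t ω) ∅)
      simp only [e]
      linarith
    have h2 := Finset.sum_le_sum fun I (_ : I ∈ J.powerset.erase ∅) =>
      le_abs_self (labelCoeff h (D.pos 0 ω) I * labelCoeff h (D.pos t ω) I)
    linarith
  calc ENNReal.ofReal (inner ω - e ω)
      ≤ ENNReal.ofReal (∑ I ∈ J.powerset.erase ∅,
          |labelCoeff h (D.pos 0 ω) I * labelCoeff h (D.pos t ω) I|) :=
        ENNReal.ofReal_le_ofReal hle
    _ = ∑ I ∈ J.powerset.erase ∅, (if I = ∅ then 0 else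
          ENNReal.ofReal |labelCoeff h (D.pos 0 ω) I * labelCoeff h (D.pos t ω) I|) := by
        rw [ENNReal.ofReal_sum_of_nonneg fun I _ => abs_nonneg _]
        refine Finset.sum_congr rfl fun I hI => ?_
        rw [if_neg (Finset.ne_of_mem_erase hI)]
    _ ≤ _ := ENNReal.sum_le_tsum _

end MuDynamics

end VoronoiPerc

/-! ### Summation over the classes -/

theorem lemma2p3 {Ω₀ : Type*} [MeasurableSpace Ω₀] (P : Measure Ω₀) [IsProbabilityMeasure P]
    (μ : Measure CadlagPath) (hμ : IsLevyLaw μ) (D : MuDynamics P μ)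
    (h : ColConfig → ℝ) (h_meas : Measurable h) (h_bdd : ∃ C : ℝ, ∀ w, |h w| ≤ C)
    (h_ne : h ≠ 0)
    (h_fin : ∀ᵐ ω ∂P, ∃ F : Finset (D.points 0 ω).carrier,
      DependsOn (restrictTo h (D.points 0 ω)) (F : Set (D.points 0 ω).carrier))
    (A B : ℕ+ → Set Config)
    (hA : ∀ i, MeasurableSet (A i)) (hB : ∀ i, MeasurableSet (B i))
    (hB_disj : Pairwise fun i j => Disjoint (B i) (B j))
    (hB_union : ⋃ i, B i = {S : Config | S.carrier.Nonempty ∧ S.carrier.Finite})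
    (hAB : ∀ i, A i ⊆ B i)
    (hB_inv : ∀ (i : ℕ+) (t : ℝ≥0), ∀ᵐ ω ∂P, ∀ I : Finset ℕ,
      D.sub I 0 ω ∈ B i ↔ D.sub I t ω ∈ B i)
    (δ₁ : ℕ+ → ℝ≥0 → ℝ) (δ₂ : ℕ+ → ℝ)
    (hδ₁ : ∀ i t, 0 < δ₁ i t) (hδ₂ : ∀ i, 0 < δ₂ i)
    (κ κ' : ℝ≥0 → Kernel Config Config)
    (hκ : ∀ t, D.IsCondLaw 0 t (κ t)) (hκ' : ∀ t, D.IsCondLaw t 0 (κ' t))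
    (hi : ∀ i t, ∀ S ∈ A i, κ t S (A i) ≤ ENNReal.ofReal (δ₁ i t))
    (hii : ∀ i t, ∀ S ∈ A i, κ' t S (A i) ≤ ENNReal.ofReal (δ₁ i t))
    (hiii : ∀ i, ENNReal.ofReal (1 - δ₂ i) * annealedSpectral P (D.points 0) h (B i) ≤
      annealedSpectral P (D.points 0) h (A i))
    (t : ℝ≥0) :
    Integrable (fun ω => h (D.colored 0 ω) * h (D.colored t ω)) P ∧
    Integrable (fun ω => quenchedExp h (D.points 0 ω) ^ 2) P ∧
    ((∫ ω, h (D.colored 0 ω) * h (D.colored t ω) ∂P : ℝ) : EReal) ≤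
      ((∫ ω, quenchedExp h (D.points 0 ω) ^ 2 ∂P : ℝ) : EReal) +
      ((∑' i : ℕ+, annealedSpectral P (D.points 0) h (B i) *
        ENNReal.ofReal (δ₁ i t + 2 * √(δ₂ i)) : ℝ≥0∞) : EReal) := by
  have : IsProbabilityMeasure μ := hμ.isProbabilityMeasure
  obtain ⟨C, hC⟩ := h_bdd
  refine ⟨D.integrable_mul_colored h_meas hC t, ?_, ?_⟩
  · refine (D.integrable_labelCoeff_sq h_meas hC 0).congr ?_
    filter_upwards [D.ae_quenchedExp_eq hμ h_meas] with ω hω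
    rw [hω]
  refine (D.integral_mul_colored_le hμ h_meas hC h_fin t).trans (add_le_add le_rfl ?_)
  refine EReal.coe_ennreal_le_coe_ennreal_iff.2 ?_
  have hm : ∀ r I, Measurable fun ω => labelCoeff h (D.pos r ω) I := fun r I =>
    (measurable_labelCoeff h_meas I).comp (D.measurable_pos r)
  have hterm : ∀ i, Measurable fun ω => ∑' I, (B i).indicator 1 (finConfig (D.pos 0 ω) I) *
      ENNReal.ofReal |labelCoeff h (D.pos 0 ω) I * labelCoeff h (D.pos t ω) I| := fun i =>
    Measurable.tsum fun I => (measurable_indicator_finConfig (hB i) (D.measurable_pos 0) I).mul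
      (((hm 0 I).mul (hm t I)).norm.ennreal_ofReal)
  calc ∫⁻ ω, ∑' I : Finset ℕ, (if I = ∅ then 0 else
        ENNReal.ofReal |labelCoeff h (D.pos 0 ω) I * labelCoeff h (D.pos t ω) I|) ∂P
      ≤ ∫⁻ ω, ∑' i, ∑' I, (B i).indicator 1 (finConfig (D.pos 0 ω) I) *
        ENNReal.ofReal |labelCoeff h (D.pos 0 ω) I * labelCoeff h (D.pos t ω) I| ∂P := by
        refine lintegral_mono fun ω => ?_
        rw [ENNReal.tsum_comm]
        refine ENNReal.tsum_le_tsum fun I => ?_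
        split_ifs with hI
        · exact zero_le
        -- A non-empty set of labels has a non-empty finite set of positions, so one of the classes
        -- contains it and the corresponding term of the double sum already dominates.
        have hmem : finConfig (D.pos 0 ω) I ∈ ⋃ i, B i := by
          rw [hB_union]
          exact ⟨(Finset.nonempty_iff_ne_empty.2 hI).to_set.image _, I.finite_toSet.image _⟩
        obtain ⟨i, hi⟩ := Set.mem_iUnion.1 hmem
        refine le_trans (le_of_eq ?_) (ENNReal.le_tsum i)
        rw [Set.indicator_of_mem hi, Pi.one_apply, one_mul]
    _ = ∑' i, ∫⁻ ω, ∑' I, (B i).indicator 1 (finConfig (D.pos 0 ω) I) *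
        ENNReal.ofReal |labelCoeff h (D.pos 0 ω) I * labelCoeff h (D.pos t ω) I| ∂P :=
        lintegral_tsum fun i => (hterm i).aemeasurable
    _ ≤ _ := ENNReal.tsum_le_tsum fun i =>
        D.lintegral_class_le hμ h_meas t (hA i) (hB i) (hAB i) (hB_inv i t) (hδ₁ i t) (hδ₂ i)
          (hκ t) (hκ' t) (hi i t) (hii i t) (hiii i)
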